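/- **Setting.** There are $K=2$ actions. In each round $t=1,\dots,T$ a context $x_t\in X$ and a reward vector $r(t)\in[0,1]^2$ are drawn, the pairs $(x_t,r(t))$ being i.i.d. from a distribution $D$; the learner sees $x_t$, chooses an action $j_t$ (possibly at random), and then sees only $r_{j_t}(t)$. The return of a learner $A$ is $G_A=\sum_{t=1}^T r_{j_t}(t)$. A policy is a map $\pi:X\to\{\text{two actions}\}$; its return is $\sum_{t=1}^T r_{\pi(x_t)}(t)$, and $G_{\max(\Pi)}$ is the largest return of a policy in the set $\Pi$ on the realized data. As a set of two-valued functions, $\Pi$ has VC dimension $d$, i.e. some $d$-point set, but no larger finite set, is shattered by $\Pi$. Assume $d\le T$ and that $\Pi$ is measurable in the following sense: for every pattern $b\in\{\text{two actions}\}^T$ the event that some $\pi\in\Pi$ has $\pi(x_t)=b_t$ for all $t\le T$ is measurable, up to null sets (this holds, e.g., for every countable set of measurable policies). Let $0<\delta<1$. Read $d\ln\frac{eT}{d}$ as $0$ if $d=0$. **Exp4.P** with $N$ experts, $K$ actions, failure parameter $\delta'$ and horizon $T'$: put $p_{\min}=\min\{\frac1K,\sqrt{\frac{\ln N}{KT'}}\}$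 and $w_i(1)=1$. In round $t$, expert $i$ gives a probability vector $\xi^i(t)$ over actions; draw $j_t$ from $p_j(t)=(1-Kp_{\min})\sum_i \frac{w_i(t)\xi^i_j(t)}{\sum_k w_k(t)}+p_{\min}$; receive $r_{j_t}(t)$; put $\hat r_j(t)=r_j(t)/p_j(t)$ if $j=j_t$ and $\hat r_j(t)=0$ otherwise, $\hat y_i(t)=\sum_j\xi^i_j(t)\hat r_j(t)$, $\hat v_i(t)=\sum_j\xi^i_j(t)/p_j(t)$ (with $0/0=0$), and $$w_i(t+1)=w_i(t)\exp\Bigl(\tfrac{p_{\min}}2\Bigl(\hat y_i(t)+\hat v_i(t)\sqrt{\tfrac{\ln(N/\delta')}{KT'}}\Bigr)\Bigr).$$ **VE.** Let $\tau$ be $\sqrt{T\,(2d\ln\frac{eT}{d}+\ln\frac2\delta)}$ rounded to an integer (down or up). For the first $\tau$ rounds (all rounds, if $\tau\ge T$) VE chooses actions uniformly at random. It then forms a finite set $\Pi'\subseteq\Pi$ by taking exactly one policy, chosen arbitrarily (possibly depending on what was observed so far), from each class of policies in $\Pi$ that agree on $x_1,\dots,x_\tau$, and in the remaining $T-\tau$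 rounds it runs Exp4.P with failure parameter $\delta/2$ and horizon $T-\tau$, started afresh, with the policies of $\Pi'$ as experts (a policy $\pi$ puts advice mass $1$ on $\pi(x_t)$), with or without one additional expert that always selects an action uniformly at random. **Theorem 3.** For all such $D$ and $\Pi$, and each of these versions of VE, with probability at least $1-\delta$ over the data and the random choices of VE, $$G_{\mathrm{VE}}\ \ge\ G_{\max(\Pi)}-9\sqrt{2T\Bigl(d\ln\frac{eT}{d}+\ln\frac2\delta\Bigr)}.$$ -/

import Mathlib

open MeasureTheory

noncomputable section

namespace Bandit

/-! ### The contextual bandit protocol -/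

/-- What the world commits to in one round: a context and one reward in `[0,1]` per action. -/
abbrev Datum (X A : Type*) := X × (A → unitInterval)

/-- What the learner has seen so far: context, chosen action and the reward of the chosen action
(and no other reward) of each past round, the most recent round first. -/
abbrev History (X A : Type*) := List (X × A × ℝ)

/-- A (randomized) learning algorithm: the law of the next action, given the past
observations and the current context. -/
abbrev Learner (X A : Type*) := History X A → X → PMF A

/-- The law of the history after `n` rounds in which `L` plays against the data `z`. -/
def Learner.run {X A : Type*} (L : Learner X A) :
    (n : ℕ) → (Fin n → Datum X A) → PMF (History X A)
  | 0, _ => PMF.pure []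
  | n + 1, z =>
    (Learner.run L n (Fin.init z)).bind fun h =>
      (L h (z (Fin.last n)).1).map fun a =>
        ((z (Fin.last n)).1, a, ((z (Fin.last n)).2 a : ℝ)) :: h

/-- The return (cumulative reward) of the learner. -/
def History.ret {X A : Type*} (h : History X A) : ℝ := (h.map fun o => o.2.2).sum

/-- The return of a deterministic policy on the data `z`. -/
def policyReturn {X A : Type*} {T : ℕ} (z : Fin T → Datum X A) (π : X → A) : ℝ :=
  ∑ t, ((z t).2 (π (z t).1) : ℝ)

/-- The return of the best policy of the class `P` on the data `z`. -/
def maxReturn {X A : Type*} {T : ℕ} (z : Fin T → Datum X A) (P : Set (X → A)) : ℝ :=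
  sSup (policyReturn z '' P)

/-! ### Exp4.P -/

section Exp4P

variable {X A ι : Type*} [Fintype A] [DecidableEq A] [Fintype ι]

/-- The mixture `p_j = (1 - K p_min) ∑ᵢ wᵢ ξⁱ_j / W + p_min`. -/
def mixProb (pmin : ℝ) (w : ι → ℝ) (ξ : ι → stdSimplex ℝ A) (j : A) : ℝ :=
  (1 - Fintype.card A * pmin) * ((∑ i, w i * (ξ i).1 j) / ∑ i, w i) + pmin

/-- `p_min = √(ln N / (K T))`, cut off at `1 / K` because a parameter in `[0, 1/K]` is required
(the cut-off is active only if `T < K ln N`). -/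
def exp4pMin (A : Type*) [Fintype A] (N T : ℕ) : ℝ :=
  min (1 / Fintype.card A) (√(Real.log N / (Fintype.card A * T)))

/-- The weights after the rounds of the history `h`, for parameter `δ` and horizon `T`. The expert
`i` gives the advice `E i x` in context `x`. -/
def exp4pWeight (E : ι → X → stdSimplex ℝ A) (δ : ℝ) (T : ℕ) : History X A → ι → ℝ
  | [] => fun _ => 1
  | (x, a, r) :: h => fun i =>
    let K : ℝ := Fintype.card A
    let N : ℝ := Fintype.card ι
    let pmin : ℝ := exp4pMin A (Fintype.card ι) T
    let p : A → ℝ := mixProb pmin (exp4pWeight E δ T h) (fun i => E i x)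
    let rhat : A → ℝ := fun j => if j = a then r / p j else 0
    let yhat : ℝ := ∑ j, (E i x).1 j * rhat j
    let vhat : ℝ := ∑ j, (E i x).1 j / p j
    exp4pWeight E δ T h i *
      Real.exp (pmin / 2 * (yhat + vhat * √(Real.log (N / δ) / (K * T))))

/-- The probability with which Exp4.P plays `j` in context `x` after the history `h`. -/
def exp4pProb (E : ι → X → stdSimplex ℝ A) (δ : ℝ) (T : ℕ) (h : History X A) (x : X) (j : A) : ℝ :=
  mixProb (exp4pMin A (Fintype.card ι) T) (exp4pWeight E δ T h) (fun i => E i x) j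

theorem exp4pWeight_pos (E : ι → X → stdSimplex ℝ A) (δ : ℝ) (T : ℕ) (h : History X A) (i : ι) :
    0 < exp4pWeight E δ T h i := by
  induction h with
  | nil => simp [exp4pWeight]
  | cons o h ih =>
    obtain ⟨x, a, r⟩ := o
    exact mul_pos ih (Real.exp_pos _)

theorem exp4pProb_nonneg (E : ι → X → stdSimplex ℝ A) (δ : ℝ) (T : ℕ) (h : History X A) (x : X)
    (j : A) : 0 ≤ exp4pProb E δ T h x j := by
  have hK : (0 : ℝ) < Fintype.card A := by
    have : Nonempty A := ⟨j⟩
    exact_mod_cast Fintype.card_pos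
  have h1 : exp4pMin A (Fintype.card ι) T ≤ 1 / Fintype.card A := min_le_left _ _
  have h0 : 0 ≤ exp4pMin A (Fintype.card ι) T := le_min (by positivity) (Real.sqrt_nonneg _)
  have h2 : 0 ≤ 1 - Fintype.card A * exp4pMin A (Fintype.card ι) T := by
    rw [le_div_iff₀ hK] at h1
    linarith
  have h3 : 0 ≤ (∑ i, exp4pWeight E δ T h i * (E i x).1 j) / ∑ i, exp4pWeight E δ T h i :=
    div_nonneg
      (Finset.sum_nonneg fun i _ => mul_nonneg (exp4pWeight_pos E δ T h i).le ((E i x).2.1 j))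
      (Finset.sum_nonneg fun i _ => (exp4pWeight_pos E δ T h i).le)
  exact add_nonneg (mul_nonneg h2 h3) h0

theorem exp4pProb_sum [Nonempty ι] (E : ι → X → stdSimplex ℝ A) (δ : ℝ) (T : ℕ)
    (h : History X A) (x : X) : ∑ j, exp4pProb E δ T h x j = 1 := by
  have hW : 0 < ∑ i, exp4pWeight E δ T h i :=
    Finset.sum_pos (fun i _ => exp4pWeight_pos E δ T h i) Finset.univ_nonempty
  have h1 : ∑ j, ∑ i, exp4pWeight E δ T h i * (E i x).1 j = ∑ i, exp4pWeight E δ T h i := by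
    rw [Finset.sum_comm]
    refine Finset.sum_congr rfl fun i _ => ?_
    rw [← Finset.mul_sum, (E i x).2.2, mul_one]
  unfold exp4pProb mixProb
  rw [Finset.sum_add_distrib, ← Finset.mul_sum, ← Finset.sum_div, h1, div_self hW.ne']
  simp

/-- Exp4.P with the experts `E`, parameter `δ` and horizon `T`. -/
def exp4p [Nonempty ι] (E : ι → X → stdSimplex ℝ A) (δ : ℝ) (T : ℕ) : Learner X A := fun h x =>
  PMF.ofFintype (fun j => ENNReal.ofReal (exp4pProb E δ T h x j)) (by
    rw [← ENNReal.ofReal_sum_of_nonneg fun j _ => exp4pProb_nonneg E δ T h x j,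
      exp4pProb_sum, ENNReal.ofReal_one])

end Exp4P

/-! ### Policy classes with two actions, and the algorithm VE -/

section VE

variable {X : Type*}

/-- The class `P` shatters the finite set `S`. -/
def Shatters (P : Set (X → Bool)) (S : Finset X) : Prop :=
  ∀ b : X → Bool, ∃ π ∈ P, ∀ x ∈ S, π x = b x

/-- The class `P` has VC dimension exactly `d`. -/
def HasVCDim (P : Set (X → Bool)) (d : ℕ) : Prop :=
  (∃ S : Finset X, S.card = d ∧ Shatters P S) ∧ ∀ S : Finset X, Shatters P S → S.card ≤ d

/-- `R` contains exactly one policy from each class of policies of `P` that give the same advice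
on the contexts `xs`. -/
def IsRepresentatives (P : Set (X → Bool)) (xs : List X) (R : Finset (X → Bool)) : Prop :=
  (∀ π ∈ R, π ∈ P) ∧ ∀ π ∈ P, ∃! π', π' ∈ R ∧ ∀ x ∈ xs, π' x = π x

/-- The advice of a deterministic policy: all mass on its action. -/
def detAdvice (π : X → Bool) (x : X) : stdSimplex ℝ Bool :=
  ⟨Pi.single (π x) 1, single_mem_stdSimplex ℝ (π x)⟩

/-- The advice that selects an action uniformly at random. -/
def unifAdvice : stdSimplex ℝ Bool :=
  ⟨fun _ => 1 / 2, fun _ => by norm_num, by simp⟩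

/-- The experts for the policies of `R`, and `u` further experts that always select an action
uniformly at random. -/
def veExperts (R : Finset (X → Bool)) (u : ℕ) : R ⊕ Fin u → X → stdSimplex ℝ Bool
  | Sum.inl π, x => detAdvice π.1 x
  | Sum.inr _, _ => unifAdvice

open Classical in
/-- The algorithm VE with horizon `T`, `τ` exploration rounds and confidence parameter `δ`. In the
first `τ` rounds the action is uniform. After them `choice`, applied to the history of the first
`τ` rounds, returns a set of policies, and the remaining `T - τ` rounds are played by Exp4.P
with these policies (and `u` uniform experts), started afresh, with failure probability `δ / 2`.
The last branch is never reached if `choice` returns representatives of a nonempty class. -/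
def VE (T τ : ℕ) (δ : ℝ) (u : ℕ) (choice : History X Bool → Finset (X → Bool)) :
    Learner X Bool := fun h x =>
  if h.length < τ then PMF.uniformOfFintype Bool
  else
    let k := h.length - τ
    let R := choice (h.drop k)
    if _hR : Nonempty (R ⊕ Fin u) then exp4p (veExperts R u) (δ / 2) (T - τ) (h.take k) x
    else PMF.uniformOfFintype Bool

/-- The number `√(T (2 d ln(eT/d) + ln(2/δ)))` of exploration rounds, before rounding
(for `d = 0` the term `2 d ln(eT/d)` is `0`). -/
def exploreLength (T d : ℕ) (δ : ℝ) : ℝ :=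
  √(T * (2 * d * Real.log (Real.exp 1 * T / d) + Real.log (2 / δ)))

/-- Measurability of the class `P` on samples of size `T` from `μ`: each event that some policy of
`P` labels the sample by the pattern `b` is `μ^T`-measurable (up to null sets). -/
def TraceMeasurable [MeasurableSpace X] (P : Set (X → Bool)) (μ : Measure X) (T : ℕ) : Prop :=
  ∀ b : Fin T → Bool,
    NullMeasurableSet {x : Fin T → X | ∃ π ∈ P, ∀ t, π (x t) = b t} (Measure.pi fun _ => μ)

end VE

end Bandit

end

/-!
The proof splits the regret of VE into three parts of order `√(T (d ln (eT/d) + ln (2/δ)))`.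

*Exploration.* The first `τ` rounds cost at most `τ`. With probability at least `1 - δ / 2`, any two
policies that agree on the first `τ` contexts disagree in fewer than `k = T L / τ` rounds altogether,
where `L = 2 d ln (eT/d) + ln (2/δ)` (`measure_hiddenDisagreement_le`). Indeed the sample is
exchangeable, so the probability may be computed by putting a fixed sample into random order
(`pi_measure_le_of_card_perm_le`). By Sauer–Shelah (`card_traces_le`) the policies produce at most
`(eT/d)^d` patterns on the sample, and `k` or more disagreements between two given patterns all avoid
the first `τ` places with probability at most `exp (- k τ / T) = exp (- L)`
(`card_perm_avoiding_le`). So the representative of the best policy loses at most `k` against it.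

*Exploitation.* For every fixed data sequence, Exp4.P competes with the representative of the best
policy with probability at least `1 - δ / 2` (`exp4p_regret`). Only this one expert has to be
compared, so the confidence bound, which is calibrated for a union bound over all experts, fails with
probability at most `δ / (2 N)`. This leaves room for the concentration of the importance-weighted
rewards, which enters the second-order term of the potential `log (∑ᵢ wᵢ)` and replaces the use of a
uniform expert. Both estimates are exponential supermartingales along a run
(`Learner.tsum_run_mul_le`, `exp4p_competes`).

*Combination.* Since `(1 - δ / 2) ^ 2 ≥ 1 - δ`, the two guarantees together give the theorem, once
the constants are added up (`regret_arith`); the bound is vacuous unless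
`T > 9 √(2T (d ln (eT/d) + ln (2/δ)))`. Only the exploration event depends on the law of the data,
and it depends on the policies only through their patterns, so no measurability of single policies or
of the choice of representatives is needed.
-/

namespace Bandit

/-! ### Expectations along a run -/

section Run

variable {X A : Type*}

theorem tsum_bind_mul {α β : Type*} (p : PMF α) (f : α → PMF β) (g : β → ENNReal) :
    ∑' b, (p.bind f) b * g b = ∑' a, p a * ∑' b, f a b * g b := by
  simp only [PMF.bind_apply, ← ENNReal.tsum_mul_right, ← ENNReal.tsum_mul_left, mul_assoc]
  exact ENNReal.tsum_comm

theorem tsum_map_mul {α β : Type*} (p : PMF α) (f : α → β) (g : β → ENNReal) :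
    ∑' b, (p.map f) b * g b = ∑' a, p a * g (f a) := by
  rw [← PMF.bind_pure_comp, tsum_bind_mul]
  refine tsum_congr fun a => ?_
  rw [tsum_eq_single (f a)]
  · simp
  · intro b hb
    simp [PMF.pure_apply, hb]

/-- A nonnegative functional of data and history that does not increase in conditional mean in any
round (a supermartingale, started afresh for every data sequence) does not increase in mean over a
whole run. -/
theorem Learner.tsum_run_mul_le (L : Learner X A)
    (Φ : (m : ℕ) → (Fin m → Datum X A) → History X A → ENNReal)
    (hstep : ∀ m (z : Fin (m + 1) → Datum X A) h,
      ∑' a, L h (z (Fin.last m)).1 a *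
        Φ (m + 1) z (((z (Fin.last m)).1, a, ((z (Fin.last m)).2 a : ℝ)) :: h) ≤
      Φ m (Fin.init z) h) (n : ℕ) (z : Fin n → Datum X A) :
    ∑' h, L.run n z h * Φ n z h ≤ Φ 0 Fin.elim0 [] := by
  induction n with
  | zero =>
    rw [tsum_eq_single []]
    · rw [Subsingleton.elim z Fin.elim0]
      simp [Learner.run]
    · intro h hh
      simp [Learner.run, PMF.pure_apply, hh]
  | succ m ih =>
    refine le_trans ?_ (ih (Fin.init z))
    rw [Learner.run, tsum_bind_mul]
    refine ENNReal.tsum_le_tsum fun h => ?_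
    rw [tsum_map_mul]
    gcongr
    exact hstep m z h

/-- Markov's inequality for a probability mass function. -/
theorem toOuterMeasure_le_of_one_le_mul {α : Type*} (p : PMF α) (g : α → ENNReal) (c : ENNReal)
    (s : Set α) (hs : ∀ a ∈ s, 1 ≤ c * g a) : p.toOuterMeasure s ≤ c * ∑' a, p a * g a := by
  rw [PMF.toOuterMeasure_apply, ← ENNReal.tsum_mul_left]
  refine ENNReal.tsum_le_tsum fun a => ?_
  by_cases ha : a ∈ s
  · rw [Set.indicator_of_mem ha, mul_left_comm]
    exact le_mul_of_one_le_right' (hs a ha)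
  · rw [Set.indicator_of_notMem ha]
    simp

theorem one_sub_le_toOuterMeasure {α : Type*} (p : PMF α) (s : Set α) {ε : ENNReal}
    (h : p.toOuterMeasure sᶜ ≤ ε) : 1 - ε ≤ p.toOuterMeasure s := by
  have h1 : (1 : ENNReal) = p.toOuterMeasure (s ∪ sᶜ) := by
    rw [Set.union_compl_self]
    exact ((PMF.toOuterMeasure_apply_eq_one_iff p _).2 (Set.subset_univ _)).symm
  rw [tsub_le_iff_right, h1]
  exact (measure_union_le s sᶜ).trans (by gcongr)

theorem Learner.run_support (L : Learner X A) (n : ℕ) (z : Fin n → Datum X A) (h : History X A)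
    (hh : h ∈ (L.run n z).support) :
    h.length = n ∧ 0 ≤ h.ret ∧ ∀ t, (z t).1 ∈ h.map Prod.fst := by
  induction n generalizing h with
  | zero =>
    simp only [Learner.run, PMF.support_pure, Set.mem_singleton_iff] at hh
    subst hh
    exact ⟨rfl, by simp [History.ret], fun t => t.elim0⟩
  | succ m ih =>
    simp only [Learner.run, PMF.mem_support_bind_iff, PMF.mem_support_map_iff] at hh
    obtain ⟨h', hh', a, -, rfl⟩ := hh
    obtain ⟨h1, h2, h3⟩ := ih (Fin.init z) h' hh'
    refine ⟨by simp [h1], ?_, fun t => ?_⟩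
    · have := ((z (Fin.last m)).2 a).2.1
      simp only [History.ret, List.map_cons, List.sum_cons] at h2 ⊢
      linarith
    · refine Fin.lastCases ?_ (fun t => ?_) t
      · simp
      · rw [List.map_cons]
        exact List.mem_cons_of_mem _ (h3 t)

theorem Learner.toOuterMeasure_run_eq_one (L : Learner X A) (n : ℕ) (z : Fin n → Datum X A)
    (s : Set (History X A)) (hs : ∀ h ∈ (L.run n z).support, h ∈ s) :
    (L.run n z).toOuterMeasure s = 1 :=
  (PMF.toOuterMeasure_apply_eq_one_iff _ _).2 hs

theorem History.ret_append (h h' : History X A) : (h ++ h').ret = h.ret + h'.ret := by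
  simp [History.ret]

/-- After the exploration phase VE is Exp4.P, started with the empty history, for the experts
chosen on the basis of the exploration phase. So a lower bound for the probability of an event under
Exp4.P that holds after every possible exploration phase holds under VE. -/
theorem run_VE_add (T τ : ℕ) (δ : ℝ) (u : ℕ) (choice : History X Bool → Finset (X → Bool))
    (hne : ∀ h, h.length = τ → Nonempty (choice h ⊕ Fin u)) (m : ℕ)
    (z : Fin (τ + m) → Datum X Bool) (s : Set (History X Bool)) (b : ENNReal)
    (hb : ∀ h ∈ ((VE T τ δ u choice).run τ fun t => z (t.castAdd m)).support,
      ∀ _ : Nonempty (choice h ⊕ Fin u),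
      b ≤ ((exp4p (veExperts (choice h) u) (δ / 2) (T - τ)).run m
        fun t => z (t.natAdd τ)).toOuterMeasure {h' | h' ++ h ∈ s}) :
    b ≤ ((VE T τ δ u choice).run (τ + m) z).toOuterMeasure s := by
  classical
  let Q : History X Bool → (k : ℕ) → (Fin k → Datum X Bool) → PMF (History X Bool) :=
    fun h k y => if hn : Nonempty (choice h ⊕ Fin u) then
      (exp4p (veExperts (choice h) u) (δ / 2) (T - τ)).run k y else PMF.pure []
  have key : ∀ m (z : Fin (τ + m) → Datum X Bool), (VE T τ δ u choice).run (τ + m) z =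
      ((VE T τ δ u choice).run τ fun t => z (t.castAdd m)).bind fun h =>
        (Q h m fun t => z (t.natAdd τ)).map fun h' => h' ++ h := by
    intro m
    induction m with
    | zero =>
      intro z
      have : ∀ h, (Q h 0 fun t => z (t.natAdd τ)) = PMF.pure [] := by
        intro h
        by_cases hn : Nonempty (choice h ⊕ Fin u) <;> simp only [Q, hn, dif_pos] <;> rfl
      simp only [this, PMF.pure_map, List.nil_append, PMF.bind_pure]
      rfl
    | succ m ih =>
      intro z
      change ((VE T τ δ u choice).run (τ + m) (Fin.init z)).bind _ = _
      rw [ih, PMF.bind_bind]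
      refine PMF.ext fun y => ?_
      rw [PMF.bind_apply, PMF.bind_apply]
      refine tsum_congr fun h => ?_
      by_cases hsupp : h ∈ ((VE T τ δ u choice).run τ fun t => z (t.castAdd (m + 1))).support
      swap
      · rw [PMF.mem_support_iff, not_not] at hsupp
        have : ((VE T τ δ u choice).run τ fun t => Fin.init z (t.castAdd m)) h = 0 := hsupp
        rw [this, hsupp, zero_mul, zero_mul]
      have hlen := ((VE T τ δ u choice).run_support τ _ h hsupp).1
      have hn := hne h hlen
      congr 1
      simp only [Q, dif_pos]
      rw [PMF.bind_map]
      simp only [Learner.run]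
      rw [PMF.map_bind]
      simp only [PMF.bind_apply]
      refine tsum_congr fun h' => ?_
      by_cases hsupp' : h' ∈ ((exp4p (veExperts (choice h) u) (δ / 2) (T - τ)).run m
          fun t => z (t.castSucc.natAdd τ)).support
      swap
      · rw [PMF.mem_support_iff, not_not] at hsupp'
        have e1 : ((exp4p (veExperts (choice h) u) (δ / 2) (T - τ)).run m
          fun t => Fin.init z (t.natAdd τ)) h' = 0 := hsupp'
        have e2 : ((exp4p (veExperts (choice h) u) (δ / 2) (T - τ)).run m
          (Fin.init fun t => z (t.natAdd τ))) h' = 0 := hsupp'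
        rw [e1, e2, zero_mul, zero_mul]
      have hlen' := (Learner.run_support _ m _ h' hsupp').1
      congr 1
      simp only [Function.comp_apply, PMF.map_comp]
      have hd : (h' ++ h).drop ((h' ++ h).length - τ) = h := by simp [hlen]
      have ht : (h' ++ h).take ((h' ++ h).length - τ) = h' := by simp [hlen]
      have hact : ∀ x, VE T τ δ u choice (h' ++ h) x =
          exp4p (veExperts (choice h) u) (δ / 2) (T - τ) h' x := by
        intro x
        unfold VE
        rw [if_neg (by simp [hlen])]
        dsimp only
        rw [ht]
        generalize (h' ++ h).drop ((h' ++ h).length - τ) = h₂ at hd ⊢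
        subst hd
        rw [dif_pos hn]
      rw [hact]
      rfl
  rw [key, PMF.toOuterMeasure_bind_apply]
  set p := (VE T τ δ u choice).run τ fun t => z (t.castAdd m) with hp
  calc b = ∑' h, p h * b := by rw [ENNReal.tsum_mul_right, p.tsum_coe, one_mul]
    _ ≤ _ := by
      refine ENNReal.tsum_le_tsum fun h => ?_
      by_cases hsupp : h ∈ p.support
      · gcongr
        have hn := hne h ((VE T τ δ u choice).run_support τ _ h hsupp).1
        rw [PMF.toOuterMeasure_map_apply]
        simp only [Q, dif_pos]
        exact hb h hsupp hn
      · rw [PMF.mem_support_iff, not_not] at hsupp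
        rw [hsupp, zero_mul, zero_mul]

end Run

/-! ### Exp4.P against one expert -/

theorem exp_neg_le_quadratic {x : ℝ} (hx : 0 ≤ x) : Real.exp (-x) ≤ 1 - x + x ^ 2 / 2 := by
  have h1 := Real.quadratic_le_exp_of_nonneg hx
  have h2 : 0 < 1 + x + x ^ 2 / 2 := by positivity
  rw [Real.exp_neg]
  refine (inv_anti₀ h2 h1).trans ?_
  rw [inv_le_iff_one_le_mul₀ h2]
  nlinarith [sq_nonneg (x ^ 2)]

theorem exp_le_quadratic {x : ℝ} (h0 : 0 ≤ x) (h1 : x ≤ 1) : Real.exp x ≤ 1 + x + x ^ 2 := by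
  have := Real.abs_exp_sub_one_sub_id_le (x := x) (by rw [abs_of_nonneg h0]; exact h1)
  linarith [(abs_le.1 this).2]

section Round

variable {A ι : Type*} [Fintype A] [Fintype ι]
  {p : ℝ} {w : ι → ℝ} (ξ : ι → stdSimplex ℝ A)

theorem le_mixProb (hpK : Fintype.card A * p ≤ 1) (hw : ∀ i, 0 < w i) (j : A) :
    p ≤ mixProb p w ξ j := by
  have : 0 ≤ (1 - Fintype.card A * p) * ((∑ i, w i * (ξ i).1 j) / ∑ i, w i) :=
    mul_nonneg (by linarith) (div_nonneg
      (Finset.sum_nonneg fun i _ => mul_nonneg (hw i).le ((ξ i).2.1 j))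
      (Finset.sum_nonneg fun i _ => (hw i).le))
  unfold mixProb
  linarith

theorem sum_div_le {P : A → ℝ} (hp : 0 < p) (hP : ∀ j, p ≤ P j) (y : stdSimplex ℝ A) :
    ∑ j, y.1 j / P j ≤ 1 / p := by
  calc ∑ j, y.1 j / P j ≤ ∑ j, y.1 j / p := by
        refine Finset.sum_le_sum fun j _ => ?_
        have := y.2.1 j
        gcongr
        exact hP j
    _ = 1 / p := by rw [← Finset.sum_div, y.2.2]

/-- One round of the weight update: the growth of `log (∑ᵢ wᵢ)` is controlled by the reward
received, up to the exploration terms and the importance-weighted reward `r / p_a`. -/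
theorem log_sum_update_le [DecidableEq A] [Nonempty ι] (hp : 0 < p) (hpK : Fintype.card A * p ≤ 1)
    (hw : ∀ i, 0 < w i) {c r : ℝ} (hc0 : 0 ≤ c) (hc1 : c ≤ 1) (hr0 : 0 ≤ r) (hr1 : r ≤ 1) (a : A) :
    (1 - Fintype.card A * p) *
      (Real.log (∑ i, w i * Real.exp (p / 2 *
        ((∑ j, (ξ i).1 j * if j = a then r / mixProb p w ξ j else 0) +
          (∑ j, (ξ i).1 j / mixProb p w ξ j) * c))) - Real.log (∑ i, w i)) ≤
    p / 2 * (r + c * Fintype.card A + p * (r / mixProb p w ξ a) + c ^ 2 * Fintype.card A) := by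
  set K : ℝ := ((Fintype.card A : ℕ) : ℝ) with hK
  set P : A → ℝ := mixProb p w ξ with hP
  have hPp : ∀ j, p ≤ P j := le_mixProb ξ hpK hw
  have hP0 : ∀ j, 0 < P j := fun j => hp.trans_le (hPp j)
  set W := ∑ i, w i with hW
  have hW0 : 0 < W := Finset.sum_pos (fun i _ => hw i) Finset.univ_nonempty
  have hmix : ∀ j, (1 - K * p) * (∑ i, w i * (ξ i).1 j) ≤ W * P j := by
    intro j
    have : P j = (1 - K * p) * ((∑ i, w i * (ξ i).1 j) / W) + p := rfl
    rw [this, mul_add, mul_left_comm W, mul_div_cancel₀ _ hW0.ne']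
    have := mul_pos hW0 hp
    linarith
  -- the exponent and its square are dominated by the linear form `∑ j, ξ j * C j` in the advice
  set C : A → ℝ := fun j => (if j = a then p / 2 * (r / P j) + p ^ 2 / 2 * (r / P j ^ 2) else 0) +
    (p / 2 * c + p / 2 * c ^ 2) / P j with hC
  have hC0 : ∀ j, 0 ≤ C j := by
    intro j
    have := hP0 j
    simp only [hC]
    split_ifs <;> positivity
  have hexp : ∀ i, Real.exp (p / 2 * ((∑ j, (ξ i).1 j * if j = a then r / P j else 0) +
      (∑ j, (ξ i).1 j / P j) * c)) ≤ 1 + ∑ j, (ξ i).1 j * C j := by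
    intro i
    have hy : (∑ j, (ξ i).1 j * if j = a then r / P j else 0) = (ξ i).1 a * (r / P a) := by simp
    set v := ∑ j, (ξ i).1 j / P j with hv
    have hv0 : 0 ≤ v := Finset.sum_nonneg fun j _ => div_nonneg ((ξ i).2.1 j) (hP0 j).le
    have hv1 : p * v ≤ 1 := by
      have := mul_le_mul_of_nonneg_left (sum_div_le hp hPp (ξ i)) hp.le
      rwa [mul_one_div_cancel hp.ne'] at this
    have hx0 := (ξ i).2.1 a
    have hx1 : (ξ i).1 a ≤ 1 := by
      rw [← (ξ i).2.2]
      exact Finset.single_le_sum (fun j _ => (ξ i).2.1 j) (Finset.mem_univ a)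
    have hrp : 0 ≤ r / P a := div_nonneg hr0 (hP0 a).le
    have hrp1 : p * (r / P a) ≤ 1 := by
      rw [← mul_div_assoc, div_le_one (hP0 a)]
      nlinarith [hPp a]
    have hlin : ∑ j, (ξ i).1 j * C j = (ξ i).1 a * (p / 2 * (r / P a) + p ^ 2 / 2 * (r / P a ^ 2)) +
        (p / 2 * c + p / 2 * c ^ 2) * v := by
      simp only [hC, mul_add, Finset.sum_add_distrib, hv, Finset.mul_sum]
      congr 1
      · simp [mul_add]
      · exact Finset.sum_congr rfl fun j _ => by ring
    rw [hy, hlin]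
    set x := (ξ i).1 a
    set s := r / P a with hs
    have hs2 : s ^ 2 ≤ r / P a ^ 2 := by
      rw [hs, div_pow]
      gcongr
      nlinarith
    have hxs1 : p * (x * s) ≤ 1 := by
      calc p * (x * s) = x * (p * s) := by ring
        _ ≤ 1 := mul_le_one₀ hx1 (by positivity) hrp1
    have hvc : p * (v * c) ≤ 1 := by
      calc p * (v * c) = (p * v) * c := by ring
        _ ≤ 1 := mul_le_one₀ hv1 hc0 hc1
    refine (exp_le_quadratic (by positivity) (by linarith)).trans ?_
    have e1 : (p / 2 * (x * s + v * c)) ^ 2 ≤ p ^ 2 / 2 * (x * s) ^ 2 + p ^ 2 / 2 * (v * c) ^ 2 := by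
      nlinarith [mul_nonneg (sq_nonneg p) (sq_nonneg (x * s - v * c))]
    have e2 : p ^ 2 / 2 * (x * s) ^ 2 ≤ x * (p ^ 2 / 2 * (r / P a ^ 2)) := by
      calc p ^ 2 / 2 * (x * s) ^ 2 = (p ^ 2 / 2) * (x * x) * s ^ 2 := by ring
        _ ≤ (p ^ 2 / 2) * (x * 1) * (r / P a ^ 2) := by gcongr
        _ = _ := by ring
    have e3 : p ^ 2 / 2 * (v * c) ^ 2 ≤ p / 2 * c ^ 2 * v := by
      calc p ^ 2 / 2 * (v * c) ^ 2 = p / 2 * c ^ 2 * v * (p * v) := by ring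
        _ ≤ p / 2 * c ^ 2 * v * 1 := by gcongr
        _ = _ := mul_one _
    linarith
  have hK1 : 0 ≤ 1 - K * p := by linarith
  set W' := ∑ i, w i * Real.exp (p / 2 * ((∑ j, (ξ i).1 j * if j = a then r / P j else 0) +
      (∑ j, (ξ i).1 j / P j) * c)) with hW'
  have hW'0 : 0 < W' :=
    Finset.sum_pos (fun i _ => mul_pos (hw i) (Real.exp_pos _)) Finset.univ_nonempty
  have h1 : W' ≤ W + ∑ j, C j * ∑ i, w i * (ξ i).1 j := by
    calc W' ≤ ∑ i, w i * (1 + ∑ j, (ξ i).1 j * C j) :=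
          Finset.sum_le_sum fun i _ => mul_le_mul_of_nonneg_left (hexp i) (hw i).le
      _ = _ := by
        simp only [mul_add, mul_one, Finset.sum_add_distrib, Finset.mul_sum, hW]
        rw [Finset.sum_comm]
        congr 1
        exact Finset.sum_congr rfl fun j _ => Finset.sum_congr rfl fun i _ => by ring
  have h2 : Real.log W' - Real.log W ≤ (∑ j, C j * ∑ i, w i * (ξ i).1 j) / W := by
    rw [← Real.log_div hW'0.ne' hW0.ne']
    refine (Real.log_le_sub_one_of_pos (by positivity)).trans ?_
    rw [sub_le_iff_le_add, div_add_one hW0.ne']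
    gcongr
    linarith
  have h3 : ∑ j, C j * P j =
      p / 2 * (r + c * K + p * (r / P a) + c ^ 2 * K) := by
    have : ∀ j, C j * P j = (if j = a then p / 2 * r + p ^ 2 / 2 * (r / P j) else 0) +
        (p / 2 * c + p / 2 * c ^ 2) := by
      intro j
      have := (hP0 j).ne'
      simp only [hC]
      split_ifs <;> field_simp
      ring
    simp only [this, Finset.sum_add_distrib, Finset.sum_ite_eq', Finset.mem_univ, if_true,
      Finset.sum_const, Finset.card_univ, nsmul_eq_mul, ← hK]
    ring
  calc (1 - K * p) * (Real.log W' - Real.log W)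
      ≤ (1 - K * p) * ((∑ j, C j * ∑ i, w i * (ξ i).1 j) / W) := by gcongr
    _ = (∑ j, C j * ((1 - K * p) * ∑ i, w i * (ξ i).1 j)) / W := by
        rw [← mul_div_assoc, Finset.mul_sum]
        congr 1
        exact Finset.sum_congr rfl fun j _ => by ring
    _ ≤ (∑ j, C j * (W * P j)) / W := by
        refine div_le_div_of_nonneg_right (Finset.sum_le_sum fun j _ => ?_) hW0.le
        exact mul_le_mul_of_nonneg_left (hmix j) (hC0 j)
    _ = ∑ j, C j * P j := by
        rw [Finset.sum_div]
        refine Finset.sum_congr rfl fun j _ => ?_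
        field_simp
    _ = _ := h3

/-- The importance-weighted estimate of the reward of an advice vector `y`, corrected by its
variance proxy, exceeds the true expected reward only with exponentially small probability:
one round of the supermartingale behind the confidence bound of Exp4.P. -/
theorem sum_mul_exp_sub_estimate_le [DecidableEq A] {P : A → ℝ} (hP : ∀ j, 0 < P j) (hPs : ∑ j, P j = 1)
    (y : stdSimplex ℝ A) (r : A → unitInterval) {c : ℝ} (hc : 0 ≤ c) :
    ∑ a, P a * Real.exp (2 * c * ((∑ j, y.1 j * (r j : ℝ)) -
      ((∑ j, y.1 j * if j = a then (r a : ℝ) / P j else 0) + (∑ j, y.1 j / P j) * c))) ≤ 1 := by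
  set g := ∑ j, y.1 j * (r j : ℝ) with hg
  set v := ∑ j, y.1 j / P j with hv
  have hy : ∀ a, (∑ j, y.1 j * if j = a then (r a : ℝ) / P j else 0) =
      y.1 a * ((r a : ℝ) / P a) := by
    intro a
    simp
  have key : ∑ a, P a * Real.exp (-(2 * c * (y.1 a * ((r a : ℝ) / P a)))) ≤
      Real.exp (-(2 * c * g) + 2 * c ^ 2 * v) := by
    refine le_trans ?_ (Real.add_one_le_exp _)
    calc ∑ a, P a * Real.exp (-(2 * c * (y.1 a * ((r a : ℝ) / P a))))
        ≤ ∑ a, (P a - 2 * c * (y.1 a * (r a : ℝ)) + 2 * c ^ 2 * (y.1 a / P a)) := by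
          refine Finset.sum_le_sum fun a _ => ?_
          have h0 := (r a).2.1
          have h1 := (r a).2.2
          have hy0 := y.2.1 a
          have hy1 : y.1 a ≤ 1 := by
            rw [← y.2.2]
            exact Finset.single_le_sum (fun j _ => y.2.1 j) (Finset.mem_univ a)
          have hPa := hP a
          refine (mul_le_mul_of_nonneg_left (exp_neg_le_quadratic (by positivity)) hPa.le).trans ?_
          have e1 : P a * (1 - 2 * c * (y.1 a * ((r a : ℝ) / P a)) +
              (2 * c * (y.1 a * ((r a : ℝ) / P a))) ^ 2 / 2) =
              P a - 2 * c * (y.1 a * (r a : ℝ)) +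
                2 * c ^ 2 * (y.1 a * y.1 a * ((r a : ℝ) * (r a : ℝ)) / P a) := by
            field_simp
          rw [e1]
          gcongr
          calc y.1 a * y.1 a * ((r a : ℝ) * (r a : ℝ)) ≤ y.1 a * 1 * (1 * 1) := by gcongr
            _ = y.1 a := by ring
      _ = -(2 * c * g) + 2 * c ^ 2 * v + 1 := by
          rw [Finset.sum_add_distrib, Finset.sum_sub_distrib, hPs, ← Finset.mul_sum,
            ← Finset.mul_sum]
          ring
  calc _ = Real.exp (2 * c * g - 2 * c ^ 2 * v) *
        ∑ a, P a * Real.exp (-(2 * c * (y.1 a * ((r a : ℝ) / P a)))) := by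
        rw [Finset.mul_sum]
        refine Finset.sum_congr rfl fun a _ => ?_
        rw [hy, mul_left_comm, ← Real.exp_add]
        congr 2
        ring
    _ ≤ Real.exp (2 * c * g - 2 * c ^ 2 * v) * Real.exp (-(2 * c * g) + 2 * c ^ 2 * v) := by
        gcongr
    _ = 1 := by
        rw [← Real.exp_add]
        simp

theorem sum_mul_exp_weighted_reward_le {P : A → ℝ} (hp : 0 < p) (hP : ∀ j, p ≤ P j)
    (hPs : ∑ j, P j = 1) (r : A → unitInterval) :
    ∑ a, P a * Real.exp (p / 2 * ((r a : ℝ) / P a)) ≤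
      Real.exp (3 / 4 * (p * Fintype.card A)) := by
  have hP0 : ∀ j, 0 < P j := fun j => hp.trans_le (hP j)
  refine le_trans ?_ (Real.add_one_le_exp _)
  calc ∑ a, P a * Real.exp (p / 2 * ((r a : ℝ) / P a))
      ≤ ∑ a, (P a + 3 / 4 * p) := by
        refine Finset.sum_le_sum fun a _ => ?_
        have h0 := (r a).2.1
        have h1 := (r a).2.2
        have hPa := hP0 a
        have hle : p / 2 * ((r a : ℝ) / P a) ≤ 1 / 2 := by
          rw [← mul_div_assoc, div_le_iff₀ hPa]
          nlinarith [hP a]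
        refine (mul_le_mul_of_nonneg_left (exp_le_quadratic (by positivity) (by linarith))
          hPa.le).trans ?_
        have e1 : P a * (p / 2 * ((r a : ℝ) / P a)) = p / 2 * r a := by field_simp
        have e2 : P a * (p / 2 * ((r a : ℝ) / P a)) ^ 2 =
            p / 2 * r a * (p / 2 * ((r a : ℝ) / P a)) := by
          field_simp
        have e3 : p / 2 * r a * (p / 2 * ((r a : ℝ) / P a)) ≤ p / 2 * 1 * (1 / 2) := by gcongr
        have e4 : p / 2 * (r a : ℝ) ≤ p / 2 * 1 := by gcongr
        rw [mul_add, mul_add, e1, e2]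
        linarith
    _ = 3 / 4 * (p * Fintype.card A) + 1 := by
        rw [Finset.sum_add_distrib, hPs, Finset.sum_const, Finset.card_univ, nsmul_eq_mul]
        ring

end Round

section Regret

variable {X A ι : Type*} [Fintype A]

/-- The return on the data `z` of an expert with advice `ξ`: its expected reward if actions are
drawn from its advice. -/
noncomputable def expertReturn {T : ℕ} (z : Fin T → Datum X A) (ξ : X → stdSimplex ℝ A) : ℝ :=
  ∑ t, ∑ j, (ξ (z t).1).1 j * ((z t).2 j : ℝ)

theorem expertReturn_succ {m : ℕ} (z : Fin (m + 1) → Datum X A) (ξ : X → stdSimplex ℝ A) :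
    expertReturn z ξ = expertReturn (Fin.init z) ξ +
      ∑ j, (ξ (z (Fin.last m)).1).1 j * ((z (Fin.last m)).2 j : ℝ) :=
  Fin.sum_univ_castSucc _

theorem expertReturn_le {T : ℕ} (z : Fin T → Datum X A) (ξ : X → stdSimplex ℝ A) :
    expertReturn z ξ ≤ T := by
  have : ∀ t, ∑ j, (ξ (z t).1).1 j * ((z t).2 j : ℝ) ≤ 1 := by
    intro t
    rw [← (ξ (z t).1).2.2]
    exact Finset.sum_le_sum fun j _ =>
      mul_le_of_le_one_right ((ξ (z t).1).2.1 j) ((z t).2 j).2.2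
  calc expertReturn z ξ ≤ ∑ _t : Fin T, (1 : ℝ) := Finset.sum_le_sum fun t _ => this t
    _ = T := by simp

variable [DecidableEq A] [Fintype ι]

theorem exp4pWeight_cons (E : ι → X → stdSimplex ℝ A) (δ : ℝ) (T : ℕ) (h : History X A)
    (x : X) (a : A) (r : ℝ) (i : ι) :
    exp4pWeight E δ T ((x, a, r) :: h) i = exp4pWeight E δ T h i *
      Real.exp (exp4pMin A (Fintype.card ι) T / 2 *
        ((∑ j, (E i x).1 j * if j = a then r / exp4pProb E δ T h x j else 0) +
          (∑ j, (E i x).1 j / exp4pProb E δ T h x j) *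
            √(Real.log (Fintype.card ι / δ) / (Fintype.card A * T)))) := rfl

theorem tsum_exp4p_mul [Nonempty ι] (E : ι → X → stdSimplex ℝ A) (δ : ℝ) (T : ℕ)
    (h : History X A) (x : X) (f : A → ℝ) (hf : ∀ a, 0 ≤ f a) :
    ∑' a, exp4p E δ T h x a * ENNReal.ofReal (f a) =
      ENNReal.ofReal (∑ a, exp4pProb E δ T h x a * f a) := by
  rw [tsum_fintype, ENNReal.ofReal_sum_of_nonneg
    fun a _ => mul_nonneg (exp4pProb_nonneg E δ T h x a) (hf a)]
  refine Finset.sum_congr rfl fun a _ => ?_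
  rw [ENNReal.ofReal_mul (exp4pProb_nonneg E δ T h x a)]
  rfl

/-- Against every fixed data sequence, Exp4.P is competitive with every single expert `i`, with
explicit failure probability. The bound comes from two exponential supermartingales: the weight of
`i` does not underestimate the return of `i` by much (failure probability `1 / a`), and the return
of Exp4.P is not much smaller than the growth of the total weight (failure probability `1 / b`). -/
theorem exp4p_competes [Nonempty ι] (E : ι → X → stdSimplex ℝ A) (δ : ℝ) (T : ℕ) {p c : ℝ}
    (hpdef : p = exp4pMin A (Fintype.card ι) T) (hp : 0 < p)
    (hpK : Fintype.card A * p ≤ 1)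
    (hcdef : c = √(Real.log (Fintype.card ι / δ) / (Fintype.card A * T)))
    (hc0 : 0 < c) (hc1 : c ≤ 1) (i : ι) {a b : ℝ} (ha : 0 < a) (hb : 0 < b)
    (n : ℕ) (z : Fin n → Datum X A) :
    ((exp4p E δ T).run n z).toOuterMeasure
      {h | h.ret < (1 - Fintype.card A * p) * (expertReturn z (E i) - Real.log a / (2 * c) -
          2 / p * Real.log (Fintype.card ι)) -
        n * (c * Fintype.card A + c ^ 2 * Fintype.card A + 3 / 2 * (p * Fintype.card A)) -
        2 * Real.log b} ≤ ENNReal.ofReal (1 / a + 1 / b) := by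
  set K : ℝ := ((Fintype.card A : ℕ) : ℝ) with hK
  set θ : ℝ := 1 - K * p with hθ
  have hθ0 : 0 ≤ θ := by linarith
  set κ : ℝ := c * K / 2 + c ^ 2 * K / 2 + 3 / 4 * (p * K) with hκ
  have hPp : ∀ h x j, p ≤ exp4pProb E δ T h x j := by
    intro h x j
    unfold exp4pProb
    rw [← hpdef]
    exact le_mixProb _ hpK (fun i => exp4pWeight_pos E δ T h i) j
  have hP0 : ∀ h x j, 0 < exp4pProb E δ T h x j := fun h x j => hp.trans_le (hPp h x j)
  let Φ₁ : (m : ℕ) → (Fin m → Datum X A) → History X A → ENNReal := fun m z h =>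
    ENNReal.ofReal (Real.exp (2 * c *
      (expertReturn z (E i) - 2 / p * Real.log (exp4pWeight E δ T h i))))
  let Φ₂ : (m : ℕ) → (Fin m → Datum X A) → History X A → ENNReal := fun m z h =>
    ENNReal.ofReal (Real.exp (θ / p * Real.log (∑ k, exp4pWeight E δ T h k) - h.ret / 2 - m * κ))
  have h₁ : ∑' h, (exp4p E δ T).run n z h * Φ₁ n z h ≤ 1 := by
    refine (Learner.tsum_run_mul_le _ Φ₁ ?_ n z).trans (le_of_eq ?_)
    · intro m z h
      simp only [Φ₁]
      rw [tsum_exp4p_mul _ _ _ _ _ _ fun a => (Real.exp_pos _).le]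
      refine ENNReal.ofReal_le_ofReal ?_
      have hround := sum_mul_exp_sub_estimate_le (hP0 h (z (Fin.last m)).1)
        (exp4pProb_sum E δ T h (z (Fin.last m)).1) (E i (z (Fin.last m)).1) (z (Fin.last m)).2
        hc0.le
      calc _ = Real.exp (2 * c * (expertReturn (Fin.init z) (E i) -
              2 / p * Real.log (exp4pWeight E δ T h i))) * _ := by
            rw [Finset.mul_sum]
            refine Finset.sum_congr rfl fun a _ => ?_
            rw [mul_left_comm, ← Real.exp_add, exp4pWeight_cons,
              Real.log_mul (exp4pWeight_pos E δ T h i).ne' (Real.exp_pos _).ne', Real.log_exp,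
              ← hpdef, ← hcdef, expertReturn_succ]
            congr 2
            field_simp
            ring
        _ ≤ _ := mul_le_of_le_one_right (Real.exp_pos _).le hround
    · simp [Φ₁, expertReturn, exp4pWeight]
  have h₂ : ∑' h, (exp4p E δ T).run n z h * Φ₂ n z h ≤
      ENNReal.ofReal (Real.exp (θ / p * Real.log (Fintype.card ι))) := by
    refine (Learner.tsum_run_mul_le _ Φ₂ ?_ n z).trans (le_of_eq ?_)
    · intro m z h
      simp only [Φ₂]
      rw [tsum_exp4p_mul _ _ _ _ _ _ fun a => (Real.exp_pos _).le]
      refine ENNReal.ofReal_le_ofReal ?_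
      set x := (z (Fin.last m)).1
      set r := (z (Fin.last m)).2
      set B := θ / p * Real.log (∑ k, exp4pWeight E δ T h k) - h.ret / 2 - m * κ with hB
      have hround := sum_mul_exp_weighted_reward_le hp (hPp h x) (exp4pProb_sum E δ T h x) r
      have hlog : ∀ a, θ / p * Real.log (∑ k, exp4pWeight E δ T ((x, a, (r a : ℝ)) :: h) k) -
          History.ret ((x, a, (r a : ℝ)) :: h) / 2 - ((m + 1 : ℕ) : ℝ) * κ ≤
          (B - 3 / 4 * (p * K)) + p / 2 * ((r a : ℝ) / exp4pProb E δ T h x a) := by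
        intro a
        have := log_sum_update_le (fun k => E k x) hp hpK (fun k => exp4pWeight_pos E δ T h k)
          hc0.le hc1 (r a).2.1 (r a).2.2 a
        have hret : History.ret ((x, a, (r a : ℝ)) :: h) = r a + h.ret := by
          simp [History.ret]
        have hmix : ∀ j, mixProb p (exp4pWeight E δ T h) (fun k => E k x) j =
            exp4pProb E δ T h x j := by
          intro j
          rw [hpdef]
          rfl
        simp only [hmix] at this
        have hcons : ∀ k, exp4pWeight E δ T ((x, a, (r a : ℝ)) :: h) k = exp4pWeight E δ T h k *
            Real.exp (p / 2 *
              ((∑ j, (E k x).1 j * if j = a then (r a : ℝ) / exp4pProb E δ T h x j else 0) +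
                (∑ j, (E k x).1 j / exp4pProb E δ T h x j) * c)) := by
          intro k
          rw [exp4pWeight_cons, ← hpdef, ← hcdef]
        simp only [hcons, hret]
        set LW := Real.log (∑ k, exp4pWeight E δ T h k)
        generalize Real.log (∑ k, exp4pWeight E δ T h k * Real.exp _) = LW' at this ⊢
        have h3 : θ / p * (LW' - LW) ≤ 1 / 2 * ((r a : ℝ) + c * K +
            p * ((r a : ℝ) / exp4pProb E δ T h x a) + c ^ 2 * K) := by
          rw [div_mul_eq_mul_div, div_le_iff₀ hp]
          linarith
        push_cast
        rw [hB]
        rw [mul_sub] at h3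
        have hκ' : κ = c * K / 2 + c ^ 2 * K / 2 + 3 / 4 * (p * K) := hκ
        linarith
      calc _ ≤ ∑ a, exp4pProb E δ T h x a * (Real.exp (B - 3 / 4 * (p * K)) *
              Real.exp (p / 2 * ((r a : ℝ) / exp4pProb E δ T h x a))) := by
            refine Finset.sum_le_sum fun a _ => mul_le_mul_of_nonneg_left ?_ (hP0 h x a).le
            rw [← Real.exp_add]
            exact Real.exp_le_exp.2 (hlog a)
        _ = Real.exp (B - 3 / 4 * (p * K)) * ∑ a, exp4pProb E δ T h x a *
              Real.exp (p / 2 * ((r a : ℝ) / exp4pProb E δ T h x a)) := by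
            rw [Finset.mul_sum]
            exact Finset.sum_congr rfl fun a _ => mul_left_comm _ _ _
        _ ≤ Real.exp (B - 3 / 4 * (p * K)) * Real.exp (3 / 4 * (p * K)) := by gcongr
        _ = Real.exp B := by rw [← Real.exp_add, sub_add_cancel]
    · simp [Φ₂, exp4pWeight, History.ret]
  set s₁ : Set (History X A) := {h | a ≤ Real.exp (2 * c *
      (expertReturn z (E i) - 2 / p * Real.log (exp4pWeight E δ T h i)))} with hs₁
  set s₂ : Set (History X A) := {h | b * Real.exp (θ / p * Real.log (Fintype.card ι)) ≤
    Real.exp (θ / p * Real.log (∑ k, exp4pWeight E δ T h k) - h.ret / 2 - n * κ)} with hs₂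
  have hm₁ : ((exp4p E δ T).run n z).toOuterMeasure s₁ ≤ ENNReal.ofReal (1 / a) := by
    refine (toOuterMeasure_le_of_one_le_mul _ (Φ₁ n z) (ENNReal.ofReal (1 / a)) s₁ ?_).trans
      (mul_le_of_le_one_right' h₁)
    intro h hh
    simp only [Φ₁]
    rw [← ENNReal.ofReal_mul (by positivity), ENNReal.one_le_ofReal, one_div,
      ← div_eq_inv_mul, one_le_div ha]
    exact hh
  have hm₂ : ((exp4p E δ T).run n z).toOuterMeasure s₂ ≤ ENNReal.ofReal (1 / b) := by
    refine (toOuterMeasure_le_of_one_le_mul _ (Φ₂ n z) (ENNReal.ofReal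
      (1 / (b * Real.exp (θ / p * Real.log (Fintype.card ι))))) s₂ ?_).trans ?_
    · intro h hh
      simp only [Φ₂]
      rw [← ENNReal.ofReal_mul (by positivity), ENNReal.one_le_ofReal, one_div,
        ← div_eq_inv_mul, one_le_div (by positivity)]
      exact hh
    · refine (mul_le_mul_right h₂ _).trans ?_
      rw [← ENNReal.ofReal_mul (by positivity)]
      refine ENNReal.ofReal_le_ofReal (le_of_eq ?_)
      field_simp
  rw [ENNReal.ofReal_add (by positivity) (by positivity)]
  refine ((measure_mono ?_).trans (measure_union_le s₁ s₂)).trans (add_le_add hm₁ hm₂)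
  intro h hh
  by_contra hcon
  simp only [hs₁, hs₂, Set.mem_union, Set.mem_ofPred_eq, not_or, not_le] at hcon
  obtain ⟨hn1, hn2⟩ := hcon
  rw [← Real.lt_log_iff_exp_lt ha] at hn1
  rw [← Real.exp_log hb, ← Real.exp_add, Real.exp_lt_exp] at hn2
  have hwi : Real.log (exp4pWeight E δ T h i) ≤ Real.log (∑ k, exp4pWeight E δ T h k) :=
    Real.log_le_log (exp4pWeight_pos E δ T h i)
      (Finset.single_le_sum (fun k _ => (exp4pWeight_pos E δ T h k).le) (Finset.mem_univ i))
  have e1 : expertReturn z (E i) - Real.log a / (2 * c) ≤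
      2 / p * Real.log (exp4pWeight E δ T h i) := by
    have : expertReturn z (E i) - 2 / p * Real.log (exp4pWeight E δ T h i) ≤
        Real.log a / (2 * c) := by
      rw [le_div_iff₀ (by positivity)]
      linarith
    linarith
  have e2 : 2 / p * Real.log (exp4pWeight E δ T h i) ≤
      2 / p * Real.log (∑ k, exp4pWeight E δ T h k) := by gcongr
  have e3 := mul_le_mul_of_nonneg_left (e1.trans e2) hθ0
  have e4 : θ / p * Real.log (∑ k, exp4pWeight E δ T h k) =
      θ * (2 / p * Real.log (∑ k, exp4pWeight E δ T h k)) / 2 := by ring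
  have e5 : θ / p * Real.log (Fintype.card ι) =
      θ * (2 / p * Real.log (Fintype.card ι)) / 2 := by ring
  simp only [Set.mem_ofPred_eq] at hh
  rw [mul_sub] at hh
  rw [e4, e5, hκ] at hn2
  linarith

end Regret

section TwoActions

variable {X : Type*}

theorem expertReturn_detAdvice {T : ℕ} (z : Fin T → Datum X Bool) (π : X → Bool) :
    expertReturn z (detAdvice π) = policyReturn z π := by
  unfold expertReturn policyReturn detAdvice
  refine Finset.sum_congr rfl fun t _ => ?_
  rw [Finset.sum_eq_single (π (z t).1)]
  · simp
  · intro j _ hj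
    simp [hj]
  · simp

/-- With a single expert, which plays the policy `π`, there is no exploration and Exp4.P plays
`π`. -/
theorem exp4p_eq_pure {ι : Type*} [Fintype ι] [Nonempty ι] (E : ι → X → stdSimplex ℝ Bool)
    (δ : ℝ) (T : ℕ) (hι : Fintype.card ι = 1) (i : ι) (π : X → Bool) (hi : E i = detAdvice π)
    (h : History X Bool) (x : X) : exp4p E δ T h x = PMF.pure (π x) := by
  have : Subsingleton ι := Fintype.card_le_one_iff_subsingleton.1 hι.le
  have huniv : (Finset.univ : Finset ι) = {i} := Finset.eq_singleton_iff_unique_mem.2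
    ⟨Finset.mem_univ _, fun k _ => Subsingleton.elim _ _⟩
  refine PMF.ext fun j => ?_
  change ENNReal.ofReal (exp4pProb E δ T h x j) = _
  have hw := exp4pWeight_pos E δ T h i
  have : exp4pProb E δ T h x j = if j = π x then 1 else 0 := by
    unfold exp4pProb mixProb exp4pMin
    rw [hι, huniv, Finset.sum_singleton, Finset.sum_singleton, mul_div_cancel_left₀ _ hw.ne']
    simp [hi, detAdvice, Pi.single_apply]
  rw [this, PMF.pure_apply]
  split_ifs <;> simp

theorem run_pure_ret {A : Type*} (L : Learner X A) (π : X → A)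
    (hL : ∀ h x, L h x = PMF.pure (π x)) (n : ℕ) (z : Fin n → Datum X A) (h : History X A)
    (hh : h ∈ (L.run n z).support) : h.ret = policyReturn z π := by
  induction n generalizing h with
  | zero =>
    simp only [Learner.run, PMF.support_pure, Set.mem_singleton_iff] at hh
    simp [hh, History.ret, policyReturn]
  | succ m ih =>
    simp only [Learner.run, PMF.mem_support_bind_iff, PMF.mem_support_map_iff, hL,
      PMF.support_pure, Set.mem_singleton_iff] at hh
    obtain ⟨h', hh', a, rfl, rfl⟩ := hh
    have h1 := ih (Fin.init z) h' hh'
    have h2 : policyReturn z π = policyReturn (Fin.init z) π +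
        ((z (Fin.last m)).2 (π (z (Fin.last m)).1) : ℝ) := Fin.sum_univ_castSucc _
    rw [h2, ← h1]
    simp only [History.ret, List.map_cons, List.sum_cons]
    exact add_comm _ _

/-- The regret bound of Exp4.P against a single expert that plays a policy, for two actions. The
failure probability `δ / 2` covers the confidence bound for this expert, which fails with
probability `δ / (2 N)`, and the concentration of the importance-weighted rewards, `δ / 4`. -/
theorem exp4p_regret {ι : Type*} [Fintype ι] [Nonempty ι] (E : ι → X → stdSimplex ℝ Bool)
    {δ : ℝ} (hδ0 : 0 < δ) (hδ1 : δ < 1) {n : ℕ} (hn : 0 < n) (i : ι) (π : X → Bool)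
    (hi : E i = detAdvice π) (hN : 2 * Real.log (Fintype.card ι) ≤ n)
    (hL : Real.log (Fintype.card ι / (δ / 2)) ≤ 2 * n) (z : Fin n → Datum X Bool) :
    ((exp4p E (δ / 2) n).run n z).toOuterMeasure
      {h | h.ret < policyReturn z π - (3 / 2 * √(2 * n * Real.log (Fintype.card ι / (δ / 2))) +
        9 / 2 * √(2 * n * Real.log (Fintype.card ι)) + Real.log (Fintype.card ι / (δ / 2)) +
        2 * Real.log (4 / δ))} ≤ ENNReal.ofReal (δ / 2) := by
  have hcard : 0 < Fintype.card ι := Fintype.card_pos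
  have hb0 : 0 ≤ Real.log (4 / δ) := Real.log_nonneg (by rw [le_div_iff₀ hδ0]; linarith)
  have hn' : (0 : ℝ) < n := by exact_mod_cast hn
  obtain h1 | h1 : Fintype.card ι = 1 ∨ 1 < Fintype.card ι := by omega
  · refine le_trans (le_of_eq ?_) zero_le
    rw [PMF.toOuterMeasure_apply_eq_zero_iff, Set.disjoint_left]
    intro h hh
    have := run_pure_ret _ π (exp4p_eq_pure E (δ / 2) n h1 i π hi) n z h hh
    have h0 : 0 ≤ Real.log (Fintype.card ι / (δ / 2)) := by
      rw [h1]
      exact Real.log_nonneg (by rw [Nat.cast_one, le_div_iff₀ (by positivity)]; linarith)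
    rw [Set.mem_ofPred_eq, this, not_lt]
    have := Real.sqrt_nonneg (2 * n * Real.log (Fintype.card ι / (δ / 2)))
    have := Real.sqrt_nonneg (2 * n * Real.log (Fintype.card ι))
    linarith
  set N : ℝ := ((Fintype.card ι : ℕ) : ℝ) with hNdef
  have hN1 : 1 < N := by rw [hNdef]; exact_mod_cast h1
  set l := Real.log N with hl
  have hl0 : 0 < l := Real.log_pos hN1
  set L := Real.log (N / (δ / 2)) with hLdef
  have hL0 : 0 < L := Real.log_pos (by rw [lt_div_iff₀ (by positivity)]; linarith)
  set p := √(l / (2 * n)) with hp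
  set c := √(L / (2 * n)) with hc
  have hp0 : 0 < p := Real.sqrt_pos.2 (by positivity)
  have hc0 : 0 < c := Real.sqrt_pos.2 (by positivity)
  have hp2 : p ≤ 1 / 2 := by
    rw [hp, Real.sqrt_le_left (by norm_num), div_le_iff₀ (by positivity)]
    linarith
  have hc1 : c ≤ 1 := by
    rw [hc, Real.sqrt_le_left zero_le_one, one_pow, div_le_one (by positivity)]
    exact hL
  have hM0 : √(2 * n * l) = 2 * n * p := by
    rw [hp, ← Real.sqrt_sq (show (0 : ℝ) ≤ 2 * n by positivity), ← Real.sqrt_mul (sq_nonneg _),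
      Real.sqrt_sq (show (0 : ℝ) ≤ 2 * n by positivity)]
    congr 1
    field_simp
  have hM : √(2 * n * L) = 2 * n * c := by
    rw [hc, ← Real.sqrt_sq (show (0 : ℝ) ≤ 2 * n by positivity), ← Real.sqrt_mul (sq_nonneg _),
      Real.sqrt_sq (show (0 : ℝ) ≤ 2 * n by positivity)]
    congr 1
    field_simp
  have hpl : l = p ^ 2 * (2 * n) := by
    rw [hp, Real.sq_sqrt (by positivity)]
    field_simp
  have hcL : L = c ^ 2 * (2 * n) := by
    rw [hc, Real.sq_sqrt (by positivity)]
    field_simp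
  have hmain := exp4p_competes E (δ / 2) n (p := p) (c := c)
    (by
      unfold exp4pMin
      rw [Fintype.card_bool, Nat.cast_ofNat, ← hNdef, ← hl, ← hp, min_eq_right hp2])
    hp0 (by rw [Fintype.card_bool]; push_cast; linarith)
    (by rw [Fintype.card_bool, Nat.cast_ofNat]) hc0 hc1 i
    (a := N / (δ / 2)) (b := 4 / δ) (by positivity) (by positivity) n z
  refine (measure_mono ?_).trans (hmain.trans (ENNReal.ofReal_le_ofReal ?_))
  · intro h hh
    rw [Set.mem_ofPred_eq] at hh ⊢
    refine hh.trans_le ?_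
    rw [hi, expertReturn_detAdvice, ← hLdef, ← hNdef, ← hl, Fintype.card_bool, hM0, hM]
    push_cast
    have hY : policyReturn z π ≤ n := by
      rw [← expertReturn_detAdvice]
      exact expertReturn_le z _
    have e1 : L / (2 * c) = n * c := by
      rw [hcL]
      field_simp
    have e2 : 2 / p * l = 4 * n * p := by
      rw [hpl]
      field_simp
      ring
    rw [e1, e2]
    have e3 : p * policyReturn z π ≤ p * n := by gcongr
    have e4 : 0 ≤ p * (n * c) := by positivity
    have e5 : 0 ≤ p * (n * p) := by positivity
    nlinarith
  · have : 1 / (N / (δ / 2)) ≤ δ / 4 := by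
      rw [one_div_div, div_le_iff₀ (by positivity)]
      have : (2 : ℝ) ≤ N := by rw [hNdef]; exact_mod_cast h1
      nlinarith
    rw [one_div_div]
    rw [one_div_div] at this
    linarith

end TwoActions

/-! ### Counting traces and permutations -/

section Traces

variable {X : Type*}

open Classical in
/-- The patterns that the policies of `P` produce on the contexts `x`. -/
noncomputable def traces {m : ℕ} (P : Set (X → Bool)) (x : Fin m → X) : Finset (Fin m → Bool) :=
  Finset.univ.filter fun b => ∃ π ∈ P, ∀ t, π (x t) = b t

theorem mem_traces {m : ℕ} {P : Set (X → Bool)} {x : Fin m → X} {b : Fin m → Bool} :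
    b ∈ traces P x ↔ ∃ π ∈ P, ∀ t, π (x t) = b t := by
  simp [traces]

/-- The Sauer–Shelah lemma for the patterns of a policy class; the contexts may repeat. -/
theorem card_traces_le {P : Set (X → Bool)} {d : ℕ} (hP : HasVCDim P d) {m : ℕ} (x : Fin m → X) :
    (traces P x).card ≤ ∑ k ∈ Finset.range (d + 1), m.choose k := by
  classical
  let f : (Fin m → Bool) → Finset (Fin m) := fun b => Finset.univ.filter fun t => b t = true
  have hf : Function.Injective f := by
    intro b b' h
    funext t
    have := Finset.ext_iff.1 h t
    simp only [f, Finset.mem_filter, Finset.mem_univ, true_and] at this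
    exact Bool.eq_iff_iff.2 this
  set 𝒜 := (traces P x).image f with h𝒜
  have hdim : 𝒜.vcDim ≤ d := by
    refine Finset.sup_le fun s hs => ?_
    rw [Finset.mem_shatterer] at hs
    have hpat : ∀ u ⊆ s, ∃ π ∈ P, ∀ t ∈ s, (π (x t) = true ↔ t ∈ u) := by
      intro u hu
      obtain ⟨v, hv, hsv⟩ := hs hu
      obtain ⟨b, hb, rfl⟩ := Finset.mem_image.1 hv
      obtain ⟨π, hπ, hπb⟩ := mem_traces.1 hb
      refine ⟨π, hπ, fun t ht => ?_⟩
      rw [hπb, ← hsv]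
      simp [f, ht]
    have hinj : Set.InjOn x s := by
      intro t ht t' ht' h
      obtain ⟨π, -, hπ⟩ := hpat {t} (by simpa using ht)
      have h1 := (hπ t ht).2 (Finset.mem_singleton_self t)
      rw [h] at h1
      exact (Finset.mem_singleton.1 ((hπ t' ht').1 h1)).symm
    rw [← Finset.card_image_of_injOn hinj]
    refine hP.2 _ fun b => ?_
    obtain ⟨π, hπ, h⟩ := hpat (s.filter fun t => b (x t) = true) (Finset.filter_subset _ _)
    refine ⟨π, hπ, fun y hy => ?_⟩
    obtain ⟨t, ht, rfl⟩ := Finset.mem_image.1 hy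
    have := h t ht
    rw [Finset.mem_filter, and_iff_right ht] at this
    exact Bool.eq_iff_iff.2 this
  calc (traces P x).card = 𝒜.card := (Finset.card_image_of_injective _ hf).symm
    _ ≤ ∑ k ∈ Finset.Iic 𝒜.vcDim, (Fintype.card (Fin m)).choose k :=
        𝒜.card_le_card_shatterer.trans Finset.card_shatterer_le_sum_vcDim
    _ ≤ ∑ k ∈ Finset.range (d + 1), m.choose k := by
        rw [Fintype.card_fin]
        refine Finset.sum_le_sum_of_subset fun k hk => ?_
        rw [Finset.mem_Iic] at hk
        rw [Finset.mem_range]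
        omega

theorem card_representatives_le {P : Set (X → Bool)} {d : ℕ} (hP : HasVCDim P d) {xs : List X}
    {R : Finset (X → Bool)} (hR : IsRepresentatives P xs R) :
    R.card ≤ ∑ k ∈ Finset.range (d + 1), xs.length.choose k := by
  refine le_trans ?_ (card_traces_le hP xs.get)
  refine Finset.card_le_card_of_injOn (fun π t => π (xs.get t)) (fun π hπ => ?_) ?_
  · exact mem_traces.2 ⟨π, hR.1 π hπ, fun t => rfl⟩
  · intro π hπ π' hπ' h
    obtain ⟨ρ, -, hρ⟩ := hR.2 π (hR.1 π hπ)
    rw [hρ π ⟨hπ, fun x _ => rfl⟩, hρ π' ⟨hπ', fun x hx => ?_⟩]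
    obtain ⟨t, rfl⟩ := List.mem_iff_get.1 hx
    exact (congrFun h t).symm

theorem sum_choose_le {d T : ℕ} (hd : 0 < d) (hdT : d ≤ T) :
    ((∑ k ∈ Finset.range (d + 1), T.choose k : ℕ) : ℝ) ≤ (Real.exp 1 * T / d) ^ d := by
  have hd' : (0 : ℝ) < d := by exact_mod_cast hd
  have hT' : (0 : ℝ) < T := by exact_mod_cast hd.trans_le hdT
  have hq1 : (d : ℝ) / T ≤ 1 := by
    rw [div_le_one hT']
    exact_mod_cast hdT
  have h1 : ((∑ k ∈ Finset.range (d + 1), T.choose k : ℕ) : ℝ) * ((d : ℝ) / T) ^ d ≤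
      Real.exp 1 ^ d := by
    calc _ = ∑ k ∈ Finset.range (d + 1), (T.choose k : ℝ) * ((d : ℝ) / T) ^ d := by
          push_cast
          rw [Finset.sum_mul]
      _ ≤ ∑ k ∈ Finset.range (d + 1), (T.choose k : ℝ) * ((d : ℝ) / T) ^ k := by
          refine Finset.sum_le_sum fun k hk => ?_
          refine mul_le_mul_of_nonneg_left ?_ (Nat.cast_nonneg _)
          exact pow_le_pow_of_le_one (by positivity) hq1 (by
            rw [Finset.mem_range] at hk
            omega)
      _ ≤ ∑ k ∈ Finset.range (T + 1), (T.choose k : ℝ) * ((d : ℝ) / T) ^ k := by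
          refine Finset.sum_le_sum_of_subset_of_nonneg (fun k hk => ?_)
            fun k _ _ => by positivity
          rw [Finset.mem_range] at hk ⊢
          omega
      _ = ((d : ℝ) / T + 1) ^ T := by
          rw [add_pow]
          exact Finset.sum_congr rfl fun k _ => by rw [one_pow]; ring
      _ ≤ Real.exp ((d : ℝ) / T) ^ T := by
          gcongr
          exact Real.add_one_le_exp _
      _ = Real.exp 1 ^ d := by
          rw [← Real.exp_nat_mul, ← Real.exp_nat_mul, mul_div_cancel₀ _ hT'.ne', mul_one]
  have h2 : (Real.exp 1 * T / d) ^ d = Real.exp 1 ^ d / ((d : ℝ) / T) ^ d := by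
    rw [← div_pow]
    congr 1
    field_simp
  rw [h2, le_div_iff₀ (by positivity)]
  exact h1

/-- The strict inequality leaves room for one additional expert. -/
theorem sum_choose_lt {d s T : ℕ} (hd : 0 < d) (hsT : s < T) :
    ∑ k ∈ Finset.range (d + 1), s.choose k < ∑ k ∈ Finset.range (d + 1), T.choose k := by
  refine Finset.sum_lt_sum (fun k _ => Nat.choose_le_choose k hsT.le) ⟨1, ?_, ?_⟩
  · rw [Finset.mem_range]
    omega
  · simpa using hsT

/-- Sampling without replacement: in a uniformly random order of `T` points, a set of points of
density `|D| / T` avoids the first `s` places with probability at most `exp (- s |D| / T)`. -/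
theorem card_perm_avoiding_le {T : ℕ} (D : Finset (Fin T)) (s : ℕ) (hs : s ≤ T) :
    ((Finset.univ.filter fun σ : Equiv.Perm (Fin T) => ∀ t : Fin T, t.val < s → σ t ∉ D).card : ℝ) ≤
      T.factorial * Real.exp (-(D.card / T)) ^ s := by
  induction s with
  | zero => simp [Fintype.card_perm]
  | succ s ih =>
    have hT0 : (0 : ℝ) < T := by exact_mod_cast (Nat.succ_pos s).trans_le hs
    have hsT : (0 : ℝ) < T - s := by
      have : (s : ℝ) < T := by exact_mod_cast hs
      linarith
    set N : ℕ → Finset (Equiv.Perm (Fin T)) := fun s =>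
      Finset.univ.filter fun σ : Equiv.Perm (Fin T) => ∀ t : Fin T, t.val < s → σ t ∉ D with hN
    have ih' := ih (Nat.le_of_succ_le hs)
    change ((N s).card : ℝ) ≤ _ at ih'
    change ((N (s + 1)).card : ℝ) ≤ _
    set F : Finset (Fin T) := Finset.univ.filter fun t => s ≤ t.val with hF
    have hlt : (Finset.univ.filter fun t : Fin T => t.val < s).card = s := by
      rw [Fin.card_filter_val_lt]
      omega
    have hFcard : (F.card : ℝ) = T - s := by
      have := Finset.card_filter_add_card_filter_not (s := (Finset.univ : Finset (Fin T)))
        (fun t => t.val < s)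
      simp only [not_lt] at this
      rw [hlt, Finset.card_univ, Fintype.card_fin] at this
      have h' : (s : ℝ) + F.card = T := by exact_mod_cast this
      linarith
    -- the place `s` may be exchanged with any later place
    have hswap : ∀ t ∈ F, ((N s).filter fun σ => σ t ∉ D).card = (N (s + 1)).card := by
      intro t ht
      have ht' : s ≤ t.val := by simpa [hF] using ht
      let s' : Fin T := ⟨s, hs⟩
      refine Finset.card_bij (fun σ _ => σ * Equiv.swap s' t) ?_ ?_ ?_
      · intro σ hσ
        simp only [hN, Finset.mem_filter, Finset.mem_univ, true_and] at hσ ⊢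
        intro i hi
        rw [Equiv.Perm.mul_apply]
        rcases Nat.lt_succ_iff_lt_or_eq.1 hi with h | h
        · rw [Equiv.swap_apply_of_ne_of_ne]
          · exact hσ.1 i h
          · exact fun h' => h.ne (congrArg Fin.val h')
          · exact fun h' => (h.trans_le ht').ne (congrArg Fin.val h')
        · have : i = s' := Fin.ext h
          rw [this, Equiv.swap_apply_left]
          exact hσ.2
      · intro σ _ σ' _ h
        exact mul_right_cancel h
      · intro σ hσ
        refine ⟨σ * Equiv.swap s' t, ?_, by rw [mul_assoc, Equiv.swap_mul_self, mul_one]⟩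
        simp only [hN, Finset.mem_filter, Finset.mem_univ, true_and] at hσ ⊢
        refine ⟨fun i h => ?_, ?_⟩
        · rw [Equiv.Perm.mul_apply, Equiv.swap_apply_of_ne_of_ne]
          · exact hσ i (h.trans (Nat.lt_succ_self s))
          · exact fun h' => h.ne (congrArg Fin.val h')
          · exact fun h' => (h.trans_le ht').ne (congrArg Fin.val h')
        · rw [Equiv.Perm.mul_apply, Equiv.swap_apply_right]
          exact hσ s' (Nat.lt_succ_self s)
    have hcount : ∀ σ ∈ N s, ((F.filter fun t => σ t ∉ D).card : ℝ) = T - s - D.card := by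
      intro σ hσ
      have h1 : (F.filter fun t => σ t ∈ D).card = D.card := by
        refine Finset.card_bij (fun t _ => σ t) ?_ ?_ ?_
        · intro t ht
          exact (Finset.mem_filter.1 ht).2
        · intro t _ t' _ h
          exact σ.injective h
        · intro y hy
          refine ⟨σ.symm y, ?_, by simp⟩
          simp only [hF, Finset.mem_filter, Finset.mem_univ, true_and, Equiv.apply_symm_apply]
          refine ⟨?_, hy⟩
          by_contra hcon
          have := (Finset.mem_filter.1 hσ).2 (σ.symm y) (not_le.1 hcon)
          rw [Equiv.apply_symm_apply] at this
          exact this hy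
      have h2 := Finset.card_filter_add_card_filter_not (s := F) (fun t => σ t ∈ D)
      rw [← hFcard, ← h2, h1]
      push_cast
      ring
    have hdouble : (T - s : ℝ) * (N (s + 1)).card = (N s).card * (T - s - D.card) := by
      calc (T - s : ℝ) * (N (s + 1)).card
          = ∑ t ∈ F, (((N s).filter fun σ => σ t ∉ D).card : ℝ) := by
            rw [Finset.sum_congr rfl fun t ht => by rw [hswap t ht], Finset.sum_const,
              nsmul_eq_mul, hFcard]
        _ = ∑ σ ∈ N s, ((F.filter fun t => σ t ∉ D).card : ℝ) := by
            exact_mod_cast Finset.sum_card_bipartiteAbove_eq_sum_card_bipartiteBelow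
              (s := F) (t := N s) (fun t σ => σ t ∉ D)
        _ = (N s).card * (T - s - D.card) := by
            rw [Finset.sum_congr rfl hcount, Finset.sum_const, nsmul_eq_mul]
    have hratio : (T - s - D.card : ℝ) ≤ (T - s) * Real.exp (-(D.card / T)) := by
      have h1 : (1 : ℝ) - D.card / T ≤ Real.exp (-(D.card / T)) := by
        have := Real.add_one_le_exp (-((D.card : ℝ) / T))
        linarith
      have h2 : (D.card : ℝ) / T * (T - s) ≤ D.card := by
        rw [div_mul_eq_mul_div, div_le_iff₀ hT0]
        exact mul_le_mul_of_nonneg_left (by linarith [(Nat.cast_nonneg s : (0 : ℝ) ≤ s)])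
          (Nat.cast_nonneg _)
      have h3 := mul_le_mul_of_nonneg_left h1 hsT.le
      linarith
    have hfin : (T - s : ℝ) * (N (s + 1)).card ≤
        (T - s) * (T.factorial * Real.exp (-(D.card / T)) ^ (s + 1)) := by
      rw [hdouble]
      calc ((N s).card : ℝ) * (T - s - D.card)
          ≤ (N s).card * ((T - s) * Real.exp (-(D.card / T))) := by gcongr
        _ ≤ (T.factorial * Real.exp (-(D.card / T)) ^ s) *
              ((T - s) * Real.exp (-(D.card / T))) := by gcongr
        _ = _ := by ring
    exact le_of_mul_le_mul_left hfin hsT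

end Traces

/-! ### The exploration phase -/

section Exploration

variable {X : Type*} [MeasurableSpace X]

theorem measurePreserving_comp_perm (μ : Measure X) [IsProbabilityMeasure μ] {T : ℕ}
    (σ : Equiv.Perm (Fin T)) :
    MeasurePreserving (fun x : Fin T → X => x ∘ σ) (Measure.pi fun _ => μ)
      (Measure.pi fun _ => μ) := by
  convert measurePreserving_piCongrLeft (fun _ : Fin T => μ) σ.symm using 1
  funext x
  funext t
  obtain ⟨i, rfl⟩ := σ.symm.surjective t
  rw [MeasurableEquiv.coe_piCongrLeft, Equiv.piCongrLeft_apply_apply]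
  simp

/-- Exchangeability: an event on an i.i.d. sample has probability at most `q` if, whatever the
sample, at most a proportion `q` of its reorderings lie in the event. -/
theorem pi_measure_le_of_card_perm_le (μ : Measure X) [IsProbabilityMeasure μ] {T : ℕ}
    {E : Set (Fin T → X)} (hE : NullMeasurableSet E (Measure.pi fun _ => μ)) {q : ℝ}
    (N : (Fin T → X) → Finset (Equiv.Perm (Fin T)))
    (hN : ∀ (x : Fin T → X) (σ : Equiv.Perm (Fin T)), x ∘ σ ∈ E → σ ∈ N x)
    (hq : ∀ x, ((N x).card : ℝ) ≤ T.factorial * q) :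
    Measure.pi (fun _ => μ) E ≤ ENNReal.ofReal q := by
  classical
  set ν : Measure (Fin T → X) := Measure.pi fun _ => μ with hν
  have hT : (0 : ℝ) < T.factorial := by exact_mod_cast T.factorial_pos
  have h1 : ∀ σ : Equiv.Perm (Fin T), ν E =
      ∫⁻ x, ((fun x : Fin T → X => x ∘ σ) ⁻¹' E).indicator 1 x ∂ν := by
    intro σ
    have hσ := measurePreserving_comp_perm μ σ
    rw [lintegral_indicator_one₀ (hE.preimage hσ.quasiMeasurePreserving),
      hσ.measure_preimage hE]
  have h2 : (T.factorial : ENNReal) * ν E ≤ ENNReal.ofReal (T.factorial * q) := by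
    calc (T.factorial : ENNReal) * ν E = ∑ _σ : Equiv.Perm (Fin T), ν E := by
          rw [Finset.sum_const, Finset.card_univ, Fintype.card_perm, Fintype.card_fin,
            nsmul_eq_mul]
      _ = ∑ σ : Equiv.Perm (Fin T),
            ∫⁻ x, ((fun x : Fin T → X => x ∘ σ) ⁻¹' E).indicator 1 x ∂ν :=
          Finset.sum_congr rfl fun σ _ => h1 σ
      _ = ∫⁻ x, ∑ σ : Equiv.Perm (Fin T),
            ((fun x : Fin T → X => x ∘ σ) ⁻¹' E).indicator 1 x ∂ν := by
          refine (lintegral_finsetSum' _ fun σ _ => ?_).symm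
          exact aemeasurable_const.indicator₀
            (hE.preimage (measurePreserving_comp_perm μ σ).quasiMeasurePreserving)
      _ ≤ ∫⁻ _x, ENNReal.ofReal (T.factorial * q) ∂ν := by
          refine lintegral_mono fun x => ?_
          calc ∑ σ : Equiv.Perm (Fin T),
                ((fun x : Fin T → X => x ∘ σ) ⁻¹' E).indicator (1 : (Fin T → X) → ENNReal) x
              ≤ ∑ σ : Equiv.Perm (Fin T), if σ ∈ N x then (1 : ENNReal) else 0 := by
                refine Finset.sum_le_sum fun σ _ => ?_
                by_cases hx : x ∘ σ ∈ E
                · rw [if_pos (hN x σ hx)]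
                  exact Set.indicator_le_self _ _ _
                · rw [Set.indicator_of_notMem (by exact hx)]
                  exact zero_le
            _ = ((N x).card : ENNReal) := by simp
            _ = ENNReal.ofReal ((N x).card : ℝ) := (ENNReal.ofReal_natCast _).symm
            _ ≤ _ := ENNReal.ofReal_le_ofReal (hq x)
      _ = ENNReal.ofReal (T.factorial * q) := by
          rw [lintegral_const, measure_univ, mul_one]
  rw [ENNReal.ofReal_mul hT.le, ENNReal.ofReal_natCast] at h2
  exact (ENNReal.mul_le_mul_iff_right (by exact_mod_cast T.factorial_ne_zero)
    (ENNReal.natCast_ne_top _)).1 h2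

/-- The samples on which two policies of `P` agree in the first `τ` rounds and still disagree in at
least `k` rounds in total. -/
def hiddenDisagreement (P : Set (X → Bool)) (T τ : ℕ) (k : ℝ) : Set (Fin T → X) :=
  {x | ∃ π ∈ P, ∃ π' ∈ P, (∀ t : Fin T, t.val < τ → π (x t) = π' (x t)) ∧
    k ≤ ((Finset.univ.filter fun t => π (x t) ≠ π' (x t)).card : ℝ)}

theorem nullMeasurableSet_hiddenDisagreement {P : Set (X → Bool)} {μ : Measure X} {T : ℕ}
    (hP : TraceMeasurable P μ T) (τ : ℕ) (k : ℝ) :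
    NullMeasurableSet (hiddenDisagreement P T τ k) (Measure.pi fun _ => μ) := by
  have : hiddenDisagreement P T τ k = ⋃ b : Fin T → Bool, ⋃ b' : Fin T → Bool,
      ⋃ _ : (∀ t : Fin T, t.val < τ → b t = b' t) ∧
        k ≤ ((Finset.univ.filter fun t => b t ≠ b' t).card : ℝ),
      {x | ∃ π ∈ P, ∀ t, π (x t) = b t} ∩ {x | ∃ π ∈ P, ∀ t, π (x t) = b' t} := by
    ext x
    simp only [hiddenDisagreement, Set.mem_ofPred_eq, Set.mem_iUnion, Set.mem_inter_iff]
    constructor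
    · rintro ⟨π, hπ, π', hπ', h1, h2⟩
      exact ⟨fun t => π (x t), fun t => π' (x t), ⟨h1, h2⟩, ⟨π, hπ, fun _ => rfl⟩,
        ⟨π', hπ', fun _ => rfl⟩⟩
    · rintro ⟨b, b', ⟨h1, h2⟩, ⟨π, hπ, hb⟩, ⟨π', hπ', hb'⟩⟩
      refine ⟨π, hπ, π', hπ', ?_⟩
      simp only [hb, hb']
      exact ⟨h1, h2⟩
  rw [this]
  exact NullMeasurableSet.iUnion fun b => NullMeasurableSet.iUnion fun b' =>
    NullMeasurableSet.iUnion fun _ => (hP b).inter (hP b')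

/-- A union bound over pairs of patterns of the whole sample, in a random order of the sample. -/
theorem measure_hiddenDisagreement_le {P : Set (X → Bool)} {μ : Measure X}
    [IsProbabilityMeasure μ] {T τ : ℕ} (hP : TraceMeasurable P μ T) (hτ : τ ≤ T) {k S : ℝ}
    (hS : ∀ x : Fin T → X, ((traces P x).card : ℝ) ≤ S) :
    Measure.pi (fun _ => μ) (hiddenDisagreement P T τ k) ≤
      ENNReal.ofReal (S ^ 2 * Real.exp (-(k * τ / T))) := by
  classical
  let dis : (Fin T → Bool) × (Fin T → Bool) → Finset (Fin T) := fun b =>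
    Finset.univ.filter fun t => b.1 t ≠ b.2 t
  let pairs : (Fin T → X) → Finset ((Fin T → Bool) × (Fin T → Bool)) := fun x =>
    (traces P x ×ˢ traces P x).filter fun b => k ≤ ((dis b).card : ℝ)
  let avoid : (Fin T → Bool) × (Fin T → Bool) → Finset (Equiv.Perm (Fin T)) := fun b =>
    Finset.univ.filter fun σ : Equiv.Perm (Fin T) => ∀ t : Fin T, t.val < τ → σ t ∉ dis b
  refine pi_measure_le_of_card_perm_le μ (nullMeasurableSet_hiddenDisagreement hP τ k)
    (fun x => (pairs x).biUnion avoid) ?_ ?_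
  · rintro x σ ⟨π, hπ, π', hπ', h1, h2⟩
    refine Finset.mem_biUnion.2 ⟨(fun t => π (x t), fun t => π' (x t)), ?_, ?_⟩
    · refine Finset.mem_filter.2 ⟨Finset.mem_product.2
        ⟨mem_traces.2 ⟨π, hπ, fun _ => rfl⟩, mem_traces.2 ⟨π', hπ', fun _ => rfl⟩⟩, ?_⟩
      refine h2.trans (le_of_eq ?_)
      congr 1
      refine Finset.card_bij (fun t _ => σ t) ?_ ?_ ?_
      · intro t ht
        simpa [dis] using ht
      · intro t _ t' _ h
        exact σ.injective h
      · intro t ht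
        refine ⟨σ.symm t, ?_, by simp⟩
        simpa [dis] using ht
    · simp only [avoid, dis, Finset.mem_filter, Finset.mem_univ, true_and, not_not, ne_eq]
      exact h1
  · intro x
    have hS0 : 0 ≤ S := (Nat.cast_nonneg _).trans (hS x)
    have havoid : ∀ b ∈ pairs x,
        ((avoid b).card : ℝ) ≤ T.factorial * Real.exp (-(k * τ / T)) := by
      intro b hb
      refine (card_perm_avoiding_le (dis b) τ hτ).trans ?_
      have hk := (Finset.mem_filter.1 hb).2
      rw [← Real.exp_nat_mul]
      refine mul_le_mul_of_nonneg_left (Real.exp_le_exp.2 ?_) (Nat.cast_nonneg _)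
      have : k * τ / T ≤ (dis b).card * τ / T := by gcongr
      calc (τ : ℝ) * -((dis b).card / T) = -((dis b).card * τ / T) := by ring
        _ ≤ _ := neg_le_neg this
    calc (((pairs x).biUnion avoid).card : ℝ) ≤ ∑ b ∈ pairs x, ((avoid b).card : ℝ) := by
          exact_mod_cast Finset.card_biUnion_le
      _ ≤ ∑ b ∈ pairs x, T.factorial * Real.exp (-(k * τ / T)) := Finset.sum_le_sum havoid
      _ = (pairs x).card * (T.factorial * Real.exp (-(k * τ / T))) := by
          rw [Finset.sum_const, nsmul_eq_mul]
      _ ≤ S ^ 2 * (T.factorial * Real.exp (-(k * τ / T))) := by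
          gcongr
          calc ((pairs x).card : ℝ) ≤ ((traces P x ×ˢ traces P x).card : ℝ) := by
                exact_mod_cast Finset.card_filter_le _ _
            _ = ((traces P x).card : ℝ) * (traces P x).card := by
                rw [Finset.card_product]
                push_cast
                rfl
            _ ≤ S * S := by
                gcongr
                · exact hS x
                · exact hS x
            _ = S ^ 2 := (sq S).symm
      _ = _ := by ring

end Exploration

/-! ### Combining exploration and exploitation -/

section Numerics

/-- The arithmetic behind the constant `9`. Here `U` is the unit of the regret bound, `ρ` the
exploration length before rounding, `τ` after rounding, `n` the number of remaining rounds,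
`T * L / τ` the loss from merging policies, `l = ln N` and `Λ = ln (2 N / δ)` for `N` experts, and
`b = ln (4 / δ)`. The second alternative of `hcase` covers a class of VC dimension `0`
with an additional uniform expert, where `Λ` may be almost twice as large as `B`, but exploration is
shorter. -/
theorem regret_arith {T n τ B U ρ L l Λ b : ℝ} (hn0 : 0 ≤ n) (hn : n ≤ T) (hU0 : 0 ≤ U)
    (hU : U ^ 2 = 2 * T * B) (hUT : 9 * U < T) (hB : 0.69 ≤ B) (hl : l ≤ B) (hρ0 : 0 ≤ ρ)
    (hρ : ρ ^ 2 = T * L) (hL : 0.69 ≤ L) (hτ0 : ρ - 1 ≤ τ) (hτ1 : τ ≤ ρ + 1)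
    (hcase : (Λ ≤ B ∧ b ≤ B ∧ ρ ^ 2 ≤ U ^ 2) ∨ (Λ ≤ 2 * B ∧ b ≤ 2 * B ∧ 2 * ρ ^ 2 ≤ U ^ 2)) :
    0 < τ ∧ τ + 2 * B ≤ T ∧
      τ + T * L / τ + (3 / 2 * √(2 * n * Λ) + 9 / 2 * √(2 * n * l) + Λ + 2 * b) ≤ 9 * U := by
  have hT0 : 0 < T := by linarith
  have hUpos : 0 < U := by
    rcases hU0.lt_or_eq with h | h
    · exact h
    · rw [← h] at hU
      nlinarith
  have hUB : 18 * B ≤ U := by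
    by_contra hcon
    have : 9 * U * U < T * U := mul_lt_mul_of_pos_right hUT hUpos
    nlinarith
  have hρ8 : 8.7 ≤ ρ := by
    by_contra hcon
    have : ρ ^ 2 < 8.7 ^ 2 := by nlinarith
    nlinarith
  have hτpos : 0 < τ := by linarith
  have hρU : ρ ≤ U := by
    refine (sq_le_sq₀ hρ0 hU0).1 ?_
    rcases hcase with h | h
    · exact h.2.2
    · nlinarith [h.2.2, sq_nonneg ρ]
  have hk : T * L / τ ≤ ρ + 1.13 := by
    rw [← hρ, div_le_iff₀ hτpos]
    nlinarith
  have hB0 : 0 ≤ B := by linarith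
  have hsqrt : ∀ y s, y ≤ s ^ 2 * B → 0 ≤ s → √(2 * n * y) ≤ s * U := by
    intro y s hy hs
    rw [Real.sqrt_le_left (by positivity), mul_pow, hU]
    have h1 := mul_le_mul_of_nonneg_left hy hn0
    have h2 := mul_le_mul_of_nonneg_right hn (mul_nonneg (sq_nonneg s) hB0)
    linarith
  have hsl : √(2 * n * l) ≤ 1 * U := hsqrt l 1 (by linarith) zero_le_one
  refine ⟨hτpos, by linarith, ?_⟩
  rcases hcase with ⟨h1, h2, -⟩ | ⟨h1, h2, h3⟩
  · have hsΛ : √(2 * n * Λ) ≤ 1 * U := hsqrt Λ 1 (by linarith) zero_le_one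
    linarith
  · have hsΛ : √(2 * n * Λ) ≤ 1.415 * U := hsqrt Λ 1.415 (by nlinarith) (by norm_num)
    have hρU' : ρ ≤ 0.708 * U := by
      refine (sq_le_sq₀ hρ0 (by positivity)).1 ?_
      nlinarith [sq_nonneg U]
    linarith

end Numerics

section Guarantee

variable {X : Type*}

/-- The shattered set in the definition makes the class nonempty, also in dimension `0`. -/
theorem HasVCDim.nonempty {P : Set (X → Bool)} {d : ℕ} (hP : HasVCDim P d) : P.Nonempty := by
  obtain ⟨S, -, hS⟩ := hP.1
  obtain ⟨π, hπ, -⟩ := hS fun _ => true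
  exact ⟨π, hπ⟩

theorem policyReturn_le {A : Type*} {T : ℕ} (z : Fin T → Datum X A) (π : X → A) :
    policyReturn z π ≤ T := by
  calc policyReturn z π ≤ ∑ _t : Fin T, (1 : ℝ) :=
        Finset.sum_le_sum fun t _ => ((z t).2 (π (z t).1)).2.2
    _ = T := by simp

/-- The best return is attained, since returns depend only on the pattern of a policy. -/
theorem exists_policyReturn_eq_maxReturn {T : ℕ} (z : Fin T → Datum X Bool) {P : Set (X → Bool)}
    (hP : P.Nonempty) : ∃ π ∈ P, policyReturn z π = maxReturn z P := by
  have hfin : (policyReturn z '' P).Finite := by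
    refine (Set.finite_range fun b : Fin T → Bool => ∑ t, ((z t).2 (b t) : ℝ)).subset ?_
    rintro _ ⟨π, -, rfl⟩
    exact ⟨fun t => π (z t).1, rfl⟩
  exact (hP.image _).csSup_mem hfin

theorem policyReturn_le_add_card {A : Type*} [DecidableEq A] {T : ℕ} (z : Fin T → Datum X A)
    (π π' : X → A) : policyReturn z π ≤ policyReturn z π' +
      ((Finset.univ.filter fun t => π (z t).1 ≠ π' (z t).1).card : ℝ) := by
  have : ((Finset.univ.filter fun t => π (z t).1 ≠ π' (z t).1).card : ℝ) =
      ∑ t, if π (z t).1 ≠ π' (z t).1 then (1 : ℝ) else 0 :=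
    (Finset.sum_boole _ _).symm
  rw [this]
  unfold policyReturn
  rw [← Finset.sum_add_distrib]
  refine Finset.sum_le_sum fun t _ => ?_
  have h1 := ((z t).2 (π (z t).1)).2.2
  have h2 := ((z t).2 (π' (z t).1)).2.1
  split_ifs with h
  · linarith
  · rw [not_not.1 h, add_zero]

theorem policyReturn_add_le {A : Type*} {τ n : ℕ} (z : Fin (τ + n) → Datum X A) (π : X → A) :
    policyReturn z π ≤ τ + policyReturn (fun t => z (t.natAdd τ)) π := by
  unfold policyReturn
  rw [Fin.sum_univ_add]
  gcongr
  exact policyReturn_le (fun t => z (t.castAdd n)) π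

/-- The guarantee of VE for data on which policies that agree during the exploration phase
disagree in fewer than `k` rounds. `C` is a bound for the regret of Exp4.P. -/
theorem run_VE_ge {P : Set (X → Bool)} (hP : P.Nonempty) {τ n u : ℕ} (hn : 0 < n) {δ : ℝ}
    (hδ0 : 0 < δ) (hδ1 : δ < 1) {choice : History X Bool → Finset (X → Bool)}
    (hchoice : ∀ h : History X Bool, h.length = τ →
      IsRepresentatives P (h.map Prod.fst) (choice h)) {k C g : ℝ}
    (hC : ∀ h : History X Bool, h.length = τ → ∀ N : ℝ, N = ((choice h).card + u : ℕ) →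
      2 * Real.log N ≤ n ∧ Real.log (N / (δ / 2)) ≤ 2 * n ∧
      3 / 2 * √(2 * n * Real.log (N / (δ / 2))) + 9 / 2 * √(2 * n * Real.log N) +
        Real.log (N / (δ / 2)) + 2 * Real.log (4 / δ) ≤ C)
    (hg : τ + k + C ≤ g) (z : Fin (τ + n) → Datum X Bool)
    (hz : (fun t => (z t).1) ∉ hiddenDisagreement P (τ + n) τ k) :
    1 - ENNReal.ofReal (δ / 2) ≤ ((VE (τ + n) τ δ u choice).run (τ + n) z).toOuterMeasure
      {h | h.ret ≥ maxReturn z P - g} := by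
  obtain ⟨π, hπ, hmax⟩ := exists_policyReturn_eq_maxReturn z hP
  have hrep : ∀ h : History X Bool, h.length = τ →
      ∃ π' ∈ choice h, ∀ x ∈ h.map Prod.fst, π' x = π x := fun h hh =>
    ((hchoice h hh).2 π hπ).exists
  refine run_VE_add (τ + n) τ δ u choice (fun h hh => ?_) n z _ _ fun h hh hne => ?_
  · obtain ⟨π', hπ', -⟩ := hrep h hh
    exact ⟨Sum.inl ⟨π', hπ'⟩⟩
  obtain ⟨hlen, hret, hctx⟩ := Learner.run_support _ τ _ h hh
  obtain ⟨π', hπ', hagree⟩ := hrep h hlen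
  rw [Nat.add_sub_cancel_left]
  have hcard : ((Fintype.card (choice h ⊕ Fin u) : ℕ) : ℝ) = ((choice h).card + u : ℕ) := by
    rw [Fintype.card_sum, Fintype.card_coe, Fintype.card_fin]
  obtain ⟨h1, h2, h3⟩ := hC h hlen _ hcard
  refine one_sub_le_toOuterMeasure _ _ ((measure_mono ?_).trans
    (exp4p_regret (veExperts (choice h) u) hδ0 hδ1 hn (Sum.inl ⟨π', hπ'⟩) π' rfl h1 h2
      fun t => z (t.natAdd τ)))
  intro h' hh'
  simp only [Set.mem_compl_iff, Set.mem_ofPred_eq, not_le, History.ret_append, ge_iff_le] at hh' ⊢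
  have hdis : ((Finset.univ.filter fun t => π (z t).1 ≠ π' (z t).1).card : ℝ) < k := by
    by_contra hcon
    refine hz ⟨π, hπ, π', (hchoice h hlen).1 π' hπ', fun t ht => ?_, not_lt.1 hcon⟩
    exact (hagree _ (hctx ⟨t.val, ht⟩)).symm
  have e1 := policyReturn_le_add_card z π π'
  have e2 := policyReturn_add_le z π'
  linarith

/-- If `f z ≥ 1 - ε` unless the contexts of `z` lie in a null measurable set of probability at most
`ε`, then `f` has mean at least `(1 - ε) ^ 2`. The integrand
need not be measurable. -/
theorem one_sub_sq_le_lintegral [MeasurableSpace X] (D : Measure (Datum X Bool))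
    [IsProbabilityMeasure D] {T : ℕ} {E : Set (Fin T → X)}
    (hE : NullMeasurableSet E (Measure.pi fun _ => D.fst)) {ε : ENNReal}
    (hEε : Measure.pi (fun _ => D.fst) E ≤ ε) (f : (Fin T → Datum X Bool) → ENNReal)
    (hf : ∀ z, (fun t => (z t).1) ∉ E → 1 - ε ≤ f z) :
    (1 - ε) ^ 2 ≤ ∫⁻ z, f z ∂(Measure.pi fun _ => D) := by
  have hpres : MeasurePreserving (fun (z : Fin T → Datum X Bool) t => (z t).1)
      (Measure.pi fun _ => D) (Measure.pi fun _ => D.fst) :=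
    measurePreserving_pi (fun _ => D) (fun _ => D.fst) fun _ => ⟨measurable_fst, rfl⟩
  set E' := (fun (z : Fin T → Datum X Bool) t => (z t).1) ⁻¹' E with hE'
  set G := (toMeasurable (Measure.pi fun _ => D) E')ᶜ with hG
  have hGm : MeasurableSet G := (measurableSet_toMeasurable _ _).compl
  have hGμ : 1 - ε ≤ (Measure.pi fun _ => D) G := by
    rw [hG, prob_compl_eq_one_sub (measurableSet_toMeasurable _ _), measure_toMeasurable,
      hpres.measure_preimage hE]
    exact tsub_le_tsub_left hEε 1
  calc (1 - ε) ^ 2 ≤ (1 - ε) * (Measure.pi fun _ => D) G := by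
        rw [sq]
        gcongr
    _ = ∫⁻ z, G.indicator (fun _ => 1 - ε) z ∂(Measure.pi fun _ => D) := by
        rw [lintegral_indicator_const hGm]
    _ ≤ _ := by
        refine lintegral_mono fun z => ?_
        by_cases hz : z ∈ G
        · rw [Set.indicator_of_mem hz]
          exact hf z fun hcon => hz (subset_toMeasurable _ _ hcon)
        · rw [Set.indicator_of_notMem hz]
          exact zero_le

end Guarantee

end Bandit

theorem theorem3 {X : Type*} [MeasurableSpace X]
    (D : Measure (Bandit.Datum X Bool)) [IsProbabilityMeasure D]
    (P : Set (X → Bool)) (d T : ℕ) (hP : Bandit.HasVCDim P d) (hdT : d ≤ T)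
    (hmeas : Bandit.TraceMeasurable P D.fst T)
    (δ : ℝ) (hδ0 : 0 < δ) (hδ1 : δ < 1)
    (τ : ℕ) (hτ : τ = ⌊Bandit.exploreLength T d δ⌋₊ ∨ τ = ⌈Bandit.exploreLength T d δ⌉₊)
    (u : ℕ) (hu : u ≤ 1)
    (choice : Bandit.History X Bool → Finset (X → Bool))
    (hchoice : ∀ h : Bandit.History X Bool, h.length = τ →
      Bandit.IsRepresentatives P (h.map Prod.fst) (choice h)) :
    ENNReal.ofReal (1 - δ) ≤
      ∫⁻ z : Fin T → Bandit.Datum X Bool,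
        ((Bandit.VE T τ δ u choice).run T z).toOuterMeasure
          {h | h.ret ≥ Bandit.maxReturn z P -
            9 * √(2 * T * (d * Real.log (Real.exp 1 * T / d) + Real.log (2 / δ)))}
        ∂(Measure.pi fun _ => D) := by
  set B : ℝ := d * Real.log (Real.exp 1 * T / d) + Real.log (2 / δ) with hB
  set U : ℝ := √(2 * T * B) with hU
  have hlog2 : 0.69 ≤ Real.log 2 := by linarith [Real.log_two_gt_d9]
  have hlogδ : Real.log 2 ≤ Real.log (2 / δ) :=
    Real.log_le_log (by norm_num) (by rw [le_div_iff₀ hδ0]; linarith)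
  -- for `d ≥ 1` the argument of the logarithm is at least `e`
  have hdlog : (d = 0 ∧ d * Real.log (Real.exp 1 * T / d) = 0) ∨
      (0 < d ∧ 1 ≤ d * Real.log (Real.exp 1 * T / d)) := by
    rcases d.eq_zero_or_pos with rfl | hd
    · simp
    · refine Or.inr ⟨hd, ?_⟩
      have hd' : (1 : ℝ) ≤ d := by exact_mod_cast hd
      have : 1 ≤ Real.log (Real.exp 1 * T / d) := by
        rw [Real.le_log_iff_exp_le (by
          have : (0 : ℝ) < T := by exact_mod_cast hd.trans_le hdT
          positivity), le_div_iff₀ (by linarith)]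
        have : (d : ℝ) ≤ T := by exact_mod_cast hdT
        gcongr
      nlinarith
  have hdlog0 : 0 ≤ d * Real.log (Real.exp 1 * T / d) := by
    rcases hdlog with h | h <;> linarith [h.2]
  have hB0 : 0.69 ≤ B := by linarith
  by_cases htriv : T ≤ 9 * U
  · -- the claimed bound is vacuous
    have : ∀ z : Fin T → Bandit.Datum X Bool,
        ((Bandit.VE T τ δ u choice).run T z).toOuterMeasure
          {h | h.ret ≥ Bandit.maxReturn z P - 9 * U} = 1 := by
      intro z
      refine Bandit.Learner.toOuterMeasure_run_eq_one _ _ _ _ fun h hh => ?_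
      obtain ⟨-, hret, -⟩ := Bandit.Learner.run_support _ _ _ h hh
      obtain ⟨π, -, hmax⟩ := Bandit.exists_policyReturn_eq_maxReturn z hP.nonempty
      have := Bandit.policyReturn_le z π
      rw [Set.mem_ofPred_eq, ← hmax]
      linarith
    simp only [this, lintegral_one, measure_univ]
    exact ENNReal.ofReal_le_one.2 (by linarith)
  rw [not_le] at htriv
  set L : ℝ := 2 * d * Real.log (Real.exp 1 * T / d) + Real.log (2 / δ) with hL
  have hL0 : 0.69 ≤ L := by
    have : 2 * d * Real.log (Real.exp 1 * T / d) = 2 * (d * Real.log (Real.exp 1 * T / d)) := by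
      ring
    linarith
  set ρ : ℝ := √(T * L) with hρ
  have hρdef : Bandit.exploreLength T d δ = ρ := rfl
  have hτρ : ρ - 1 ≤ τ ∧ (τ : ℝ) ≤ ρ + 1 := by
    have hρ0 : 0 ≤ ρ := Real.sqrt_nonneg _
    rw [hρdef] at hτ
    rcases hτ with rfl | rfl
    · exact ⟨(Nat.sub_one_lt_floor ρ).le, by linarith [Nat.floor_le hρ0]⟩
    · exact ⟨by linarith [Nat.le_ceil ρ], (Nat.ceil_lt_add_one hρ0).le⟩
  have hU2 : U ^ 2 = 2 * T * B := Real.sq_sqrt (by positivity)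
  have hρ2 : ρ ^ 2 = T * L := Real.sq_sqrt (by positivity)
  have hlog4 : Real.log (4 / δ) = Real.log 2 + Real.log (2 / δ) := by
    rw [← Real.log_mul (by norm_num) (by positivity)]
    congr 1
    ring
  -- bounds on the number `N` of experts in terms of the dimension
  have hcase : ∀ h : Bandit.History X Bool, h.length = τ → τ < T → ∀ N : ℝ,
      N = ((choice h).card + u : ℕ) → Real.log N ≤ B ∧
      ((Real.log (N / (δ / 2)) ≤ B ∧ Real.log (4 / δ) ≤ B ∧ ρ ^ 2 ≤ U ^ 2) ∨
        (Real.log (N / (δ / 2)) ≤ 2 * B ∧ Real.log (4 / δ) ≤ 2 * B ∧ 2 * ρ ^ 2 ≤ U ^ 2)) := by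
    intro h hh hτT N hN
    have hR := Bandit.card_representatives_le hP (hchoice h hh)
    rw [List.length_map, hh] at hR
    obtain ⟨π, hπ⟩ := hP.nonempty
    obtain ⟨π', ⟨hπ', -⟩, -⟩ := (hchoice h hh).2 π hπ
    have hRpos : 0 < (choice h).card := Finset.card_pos.2 ⟨π', hπ'⟩
    have hN0 : 0 < N := by
      rw [hN]
      exact_mod_cast (by omega : 0 < (choice h).card + u)
    have hlogN : Real.log (N / (δ / 2)) = Real.log N + Real.log (2 / δ) := by
      rw [← Real.log_mul (by positivity) (by positivity)]
      congr 1
      field_simp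
    have hT0 : (0 : ℝ) ≤ T := Nat.cast_nonneg T
    rcases hdlog with ⟨h0, h1⟩ | ⟨h0, h1⟩
    · have hN2 : N ≤ 2 := by
        rw [h0] at hR
        simp only [zero_add, Finset.range_one, Finset.sum_singleton, Nat.choose_zero_right] at hR
        rw [hN]
        exact_mod_cast (by omega : (choice h).card + u ≤ 2)
      have := Real.log_le_log hN0 hN2
      have hLB : L = B := by
        rw [hL, hB, mul_assoc, h1]
        ring
      refine ⟨by linarith, Or.inr ⟨by linarith, by linarith, ?_⟩⟩
      rw [hρ2, hU2, hLB]
      linarith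
    · have hNS : N ≤ (Real.exp 1 * T / d) ^ d := by
        refine le_trans ?_ (Bandit.sum_choose_le h0 hdT)
        rw [hN]
        have := Bandit.sum_choose_lt h0 hτT
        exact_mod_cast (by omega : (choice h).card + u ≤
          ∑ k ∈ Finset.range (d + 1), T.choose k)
      have := Real.log_le_log hN0 hNS
      rw [Real.log_pow] at this
      refine ⟨by linarith, Or.inl ⟨by linarith, by linarith [Real.log_two_lt_d9], ?_⟩⟩
      rw [hρ2, hU2]
      have : L ≤ 2 * B := by
        rw [hL, hB]
        linarith
      nlinarith
  have hτ0 := hτρ.1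
  have hτ1 := hτρ.2
  -- the exploration phase is shorter than the horizon
  have hρU : ρ ^ 2 ≤ U ^ 2 := by
    rw [hρ2, hU2]
    have : L ≤ 2 * B := by
      rw [hL, hB]
      linarith
    have hT0 : (0 : ℝ) ≤ T := Nat.cast_nonneg T
    nlinarith
  obtain ⟨hτpos, hτB, -⟩ := Bandit.regret_arith (n := T) (l := 0) (Λ := 0) (b := 0)
    (Nat.cast_nonneg T) le_rfl (Real.sqrt_nonneg _) hU2 htriv hB0 (by linarith)
    (Real.sqrt_nonneg _) hρ2 hL0 hτ0 hτ1 (Or.inl ⟨by linarith, by linarith, hρU⟩)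
  have hτT : τ < T := by
    have : (τ : ℝ) < T := by linarith
    exact_mod_cast this
  obtain ⟨n, hTn⟩ := Nat.exists_eq_add_of_le hτT.le
  have hn : 0 < n := by omega
  have hTcast : (T : ℝ) = τ + n := by
    rw [hTn]
    push_cast
    rfl
  have hT0 : (0 : ℝ) < T := by linarith
  set k : ℝ := T * L / τ with hk
  have hS : ∀ x : Fin T → X,
      ((Bandit.traces P x).card : ℝ) ≤ Real.exp (d * Real.log (Real.exp 1 * T / d)) := by
    intro x
    have htr : ((Bandit.traces P x).card : ℝ) ≤
        ((∑ j ∈ Finset.range (d + 1), T.choose j : ℕ) : ℝ) := by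
      exact_mod_cast Bandit.card_traces_le hP x
    refine htr.trans ?_
    rcases hdlog with ⟨h0, h1⟩ | ⟨h0, -⟩
    · rw [h1, h0]
      simp
    · refine (Bandit.sum_choose_le h0 hdT).trans (le_of_eq ?_)
      have : (0 : ℝ) < d := by exact_mod_cast h0
      rw [Real.exp_nat_mul, Real.exp_log (by positivity)]
  have hEμ : Measure.pi (fun _ => D.fst) (Bandit.hiddenDisagreement P T τ k) ≤
      ENNReal.ofReal (δ / 2) := by
    refine (Bandit.measure_hiddenDisagreement_le hmeas hτT.le hS).trans
      (ENNReal.ofReal_le_ofReal (le_of_eq ?_))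
    have hkL : k * τ / T = L := by
      rw [hk]
      field_simp
    rw [hkL, ← Real.exp_nat_mul, ← Real.exp_add]
    have : ((2 : ℕ) : ℝ) * (d * Real.log (Real.exp 1 * T / d)) + -L = -Real.log (2 / δ) := by
      rw [hL]
      push_cast
      ring
    rw [this, Real.exp_neg, Real.exp_log (by positivity), inv_div]
  refine le_trans ?_ (Bandit.one_sub_sq_le_lintegral D
    (Bandit.nullMeasurableSet_hiddenDisagreement hmeas τ k) hEμ _ fun z hz => ?_)
  · rw [← ENNReal.ofReal_one, ← ENNReal.ofReal_sub 1 (by positivity),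
      ← ENNReal.ofReal_pow (by linarith)]
    refine ENNReal.ofReal_le_ofReal ?_
    nlinarith [sq_nonneg δ]
  · have hreg : ∀ h : Bandit.History X Bool, h.length = τ → ∀ N : ℝ,
        N = ((choice h).card + u : ℕ) →
        2 * Real.log N ≤ n ∧ Real.log (N / (δ / 2)) ≤ 2 * n ∧
        3 / 2 * √(2 * n * Real.log (N / (δ / 2))) + 9 / 2 * √(2 * n * Real.log N) +
          Real.log (N / (δ / 2)) + 2 * Real.log (4 / δ) ≤ 9 * U - τ - k := by
      intro h hh N hN
      obtain ⟨h1, h2⟩ := hcase h hh hτT N hN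
      obtain ⟨-, -, h3⟩ := Bandit.regret_arith (n := n) (Nat.cast_nonneg n) (by linarith)
        (Real.sqrt_nonneg _) hU2 htriv hB0 h1 (Real.sqrt_nonneg _) hρ2 hL0 hτ0 hτ1 h2
      refine ⟨by linarith, ?_, by linarith⟩
      rcases h2 with h2 | h2 <;> linarith [h2.1]
    clear_value U k
    subst hTn
    exact Bandit.run_VE_ge hP.nonempty hn hδ0 hδ1 hchoice hreg (by linarith) z hz
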